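/- Let $G$ be a locally compact, $\sigma$-compact (Hausdorff) abelian group, written additively, with Haar measure $|\cdot|$ (integration with respect to it is written $dt$) and dual group $\widehat G$ of continuous homomorphisms $\xi:G\to\mathbb T$. Let $(B_n)_{n\in\mathbb N}$ be a F\o lner sequence in $G$: each $B_n$ is a nonempty open relatively compact set, and $|B_n\,\triangle\,(t+B_n)|/|B_n|\to0$ for every $t\in G$. Let $(X,d)$ be a compact metric space with its Borel $\sigma$-algebra and a continuous action $G\times X\to X$, $(t,x)\mapsto tx$. **Almost periodicity.** For $n\in\mathbb N$ and $x,y\in X$ put $D_n(x,y)=\sup_{s\in G}\frac1{|B_n|}\int_{B_n+s}d(tx,ty)\,dt$. A set $A\subseteq G$ is relatively dense if $G=\bigcup_{a\in A}(a+K)$ for some compact $K\subseteq G$. A point $x\in X$ is *Weyl almost periodic* if for every $\varepsilon>0$ there is an $N\in\mathbb N$ such that $\{t\in G: D_N(x,tx)<\varepsilon\}$ is relatively dense. A point $x\in X$ is *Besicovitch almost periodic* if for every $f\in C(X)$ (continuous, complex-valued) and every $\varepsilon>0$ there are finitely many $\xi_1,\dots,\xi_k\in\widehat G$ and $c_1,\dots,c_k\in\mathbb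 C$ with $$\limsup_{n\to\infty}\frac1{|B_n|}\int_{B_n}\Bigl|f(tx)-\sum_{j=1}^kc_j\xi_j(t)\Bigr|\,dt<\varepsilon .$$ For such $x$, $\mathrm{Freq}(x)$ is the set of all $\xi\in\widehat G$ for which there is an $f\in C(X)$ with $\lim_{n\to\infty}\frac1{|B_n|}\int_{B_n}f(tx)\overline{\xi(t)}\,dt\neq0$. **Spectrum.** $(X,G)$ is uniquely ergodic if there is exactly one $G$-invariant Borel probability measure $m$ on $X$. An eigenfunction is an $f\in L^2(X,m)$, $f\ne0$, such that for every $t\in G$ there is $\xi(t)\in\mathbb C$ with $f(t\,\cdot)=\xi(t)f$ in $L^2(X,m)$; the map $\xi$ (which then belongs to $\widehat G$) is its eigenvalue, and $\mathrm{Eig}(X,G,m)\subseteq\widehat G$ is the set of all eigenvalues. The system has pure point spectrum if $L^2(X,m)$ has an orthonormal basis of eigenfunctions. It has continuous eigenfunctions if every eigenfunction, with eigenvalue $\xi$, agrees $m$-almost everywhere with a continuous $g:X\to\mathbb C$ satisfying $g(tx)=\xi(t)g(x)$ for all $t\in G$ and all $x\in X$. **Theorem.** Let $p\in X$ be transitive,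 i.e. $\overline{\{tp:t\in G\}}=X$. The following are equivalent: 1. $(X,G)$ is uniquely ergodic with pure point spectrum and continuous eigenfunctions. 2. The point $p$ is Weyl almost periodic. 3. Every $x\in X$ is Weyl almost periodic. In this case, denoting by $m$ the unique invariant probability measure, every $x\in X$ is Besicovitch almost periodic and $\mathrm{Freq}(x)=\mathrm{Eig}(X,G,m)$ for all $x\in X$. -/

import Mathlib

open MeasureTheory Filter Topology
open scoped Pointwise

/- The abelian group `G` is written multiplicatively, `t • x` is the action of `t : G` on `x : X`,
and `s • A` is the translate of `A ⊆ G` by `s`.  The dual group is `PontryaginDual G`. -/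

section Group

variable {G : Type*} [CommGroup G] [TopologicalSpace G]

/-- A set `A ⊆ G` is relatively dense if its translates by a compact set cover `G`:
`G = ⋃_{a ∈ A} a K` for some compact `K`. -/
def RelativelyDense (A : Set G) : Prop :=
  ∃ K : Set G, IsCompact K ∧ (⋃ a ∈ A, a • K) = Set.univ

variable [MeasurableSpace G]

/-- A Følner sequence of nonempty open relatively compact sets:
`|t B_n ∆ B_n| / |B_n| → 0` for every `t`. -/
structure IsFolnerSequence (μ : Measure G) (B : ℕ → Set G) : Prop where
  isOpen : ∀ n, IsOpen (B n)
  nonempty : ∀ n, (B n).Nonempty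
  relativelyCompact : ∀ n, IsCompact (closure (B n))
  foelner : IsFoelner G μ atTop B

/-- `|B_n|⁻¹ ∫_{s B_n} f`. -/
noncomputable def windowMean {E : Type*} [NormedAddCommGroup E] [NormedSpace ℝ E]
    (μ : Measure G) (B : ℕ → Set G) (n : ℕ) (s : G) (f : G → E) : E :=
  (μ.real (B n))⁻¹ • ∫ t in s • B n, f t ∂μ

/-- The upper mean `limsup_n |B_n|⁻¹ ∫_{B_n} h` of a bounded measurable `h`. -/
noncomputable def upperMean (μ : Measure G) (B : ℕ → Set G) (h : G → ℝ) : ℝ :=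
  limsup (fun n => windowMean μ B n 1 h) atTop

/-- The uniform upper mean on level `n`, `sup_s |B_n|⁻¹ ∫_{s B_n} h`, of a bounded measurable
`h`. -/
noncomputable def uniformMean (μ : Measure G) (B : ℕ → Set G) (n : ℕ) (h : G → ℝ) : ℝ :=
  ⨆ s : G, windowMean μ B n s h

/-- The average of `h` along `B` exists and equals `a`. -/
def HasAverage (μ : Measure G) (B : ℕ → Set G) (h : G → ℂ) (a : ℂ) : Prop :=
  Tendsto (fun n => windowMean μ B n 1 h) atTop (𝓝 a)

/-- Besicovitch almost periodicity of a bounded measurable function: approximation by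
trigonometric polynomials with respect to the upper mean. -/
def BesicovitchAlmostPeriodicFun (μ : Measure G) (B : ℕ → Set G) (h : G → ℂ) : Prop :=
  ∀ ε > 0, ∃ (k : ℕ) (ξ : Fin k → PontryaginDual G) (c : Fin k → ℂ),
    upperMean μ B (fun t => ‖h t - ∑ j, c j * (ξ j t : ℂ)‖) < ε

end Group

section Points

variable {G X : Type*} [CommGroup G] [TopologicalSpace G] [MeasurableSpace G]
  [MetricSpace X] [MulAction G X]

/-- The averaged pseudometric on level `n`: `D_n(x,y) = sup_s |B_n|⁻¹ ∫_{s B_n} d(tx, ty) dt`. -/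
noncomputable def averagedDist (μ : Measure G) (B : ℕ → Set G) (n : ℕ) (x y : X) : ℝ :=
  uniformMean μ B n (fun t => dist (t • x) (t • y))

/-- Weyl almost periodic points. -/
def WeylAlmostPeriodicPoint (μ : Measure G) (B : ℕ → Set G) (x : X) : Prop :=
  ∀ ε > 0, ∃ N : ℕ, RelativelyDense {t : G | averagedDist μ B N x (t • x) < ε}

/-- Besicovitch almost periodic points: all functions `t ↦ f(tx)`, `f ∈ C(X)`, are Besicovitch
almost periodic. -/
def BesicovitchAlmostPeriodicPoint (μ : Measure G) (B : ℕ → Set G) (x : X) : Prop :=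
  ∀ f : C(X, ℂ), BesicovitchAlmostPeriodicFun μ B (fun t => f (t • x))

/-- The frequencies of a (Besicovitch almost periodic) point `x`: the characters `ξ` for which the
average of `t ↦ f(tx) * conj (ξ t)` is nonzero for some `f ∈ C(X)`. -/
def Freq (μ : Measure G) (B : ℕ → Set G) (x : X) : Set (PontryaginDual G) :=
  {ξ | ∃ (f : C(X, ℂ)) (a : ℂ), a ≠ 0 ∧
    HasAverage μ B (fun t => f (t • x) * (starRingEnd ℂ) (ξ t : ℂ)) a}

end Points

section Spectrum

variable {G X : Type*} [CommGroup G] [TopologicalSpace X] [MeasurableSpace X] [MulAction G X]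

/-- `m` is the one and only `G`-invariant (Borel) probability measure on `X`. -/
def IsUniqueInvariantMeasure (G : Type*) [CommGroup G] [MulAction G X] (m : Measure X) : Prop :=
  (IsProbabilityMeasure m ∧ SMulInvariantMeasure G X m) ∧
    ∀ m' : Measure X, IsProbabilityMeasure m' → SMulInvariantMeasure G X m' → m' = m

/-- `f ∈ L²(X,m)` is nonzero and `f(t·) = ξ(t) f` in `L²(X,m)` for all `t : G`. -/
def IsEigenfunctionFor (m : Measure X) (ξ : G → ℂ) (f : Lp ℂ 2 m) : Prop :=
  f ≠ 0 ∧ ∀ t : G, (fun x => f (t • x)) =ᵐ[m] fun x => ξ t * f x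

/-- There is an orthonormal basis of `L²(X,m)` consisting of eigenfunctions. -/
def HasPurePointSpectrum (G : Type*) [CommGroup G] [MulAction G X] (m : Measure X) : Prop :=
  ∃ (S : Set (Lp ℂ 2 m)) (b : HilbertBasis S ℂ (Lp ℂ 2 m)),
    ⇑b = ((↑) : S → Lp ℂ 2 m) ∧ ∀ f ∈ S, ∃ ξ : G → ℂ, IsEigenfunctionFor m ξ f

/-- Every eigenfunction in `L²(X,m)` has a representative that is a continuous eigenfunction of
`(X,G)`, that is, a continuous function satisfying the eigenvalue equation at every point. -/
def HasContinuousEigenfunctions (G : Type*) [CommGroup G] [MulAction G X] (m : Measure X) : Prop :=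
  ∀ (ξ : G → ℂ) (f : Lp ℂ 2 m), IsEigenfunctionFor m ξ f →
    ∃ g : C(X, ℂ), ⇑f =ᵐ[m] ⇑g ∧ ∀ (t : G) (x : X), g (t • x) = ξ t * g x

/-- The set of eigenvalues of `(X,G,m)`, as a subset of the dual group. -/
def Eig (G : Type*) [CommGroup G] [TopologicalSpace G] [MulAction G X] (m : Measure X) :
    Set (PontryaginDual G) :=
  {χ | ∃ f : Lp ℂ 2 m, IsEigenfunctionFor m (fun t : G => (χ t : ℂ)) f}

end Spectrum

/-! From a Weyl almost periodic transitive point to the spectrum: relative density makes a compact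
piece `K • p` of the orbit `ε`-dense in `X` for some `D_N`, and compactness of `K` turns this into a
finite net, hence into mean equicontinuity (`WeylAlmostPeriodicPoint.eventually_averagedDist_le`).
The level `N` depends on `ε`, but the upper mean distance `D` (`meanDist`) lies below every `D_N`;
so `D` is one continuous invariant pseudometric. All orbits have asymptotically the same averages as
that of `p`, which gives unique ergodicity. The kernel `max (δ - D) 0` is continuous, symmetric and
invariant. It defines a compact self-adjoint operator with continuous functions as values, commuting
with `G`. Its eigenspaces for nonzero eigenvalues are finite-dimensional and `G`-invariant, so they
are spanned by continuous eigenfunctions (`kernelOperator_mem_eigenfunctionSpace`). After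
normalisation these operators approximate the identity as `δ → 0`
(`norm_toLp_sub_kernelOperator_sq_le`), so continuous eigenfunctions are total in `L²`. Conversely,
let continuous eigenfunctions be total. Unique ergodicity makes the `L²` approximation of a
continuous function by them uniform in the mean along all orbits (`exists_eigenfunction_approx`).
Finite sums of eigenfunctions are almost invariant under Bohr neighbourhoods of the identity, and
these are relatively dense; as finitely many functions control the metric, every point is Weyl
almost periodic. On an orbit such sums are trigonometric polynomials, whence Besicovitch almost
periodicity and the frequencies. -/

set_option linter.unusedSectionVars false

/-! ### Means along a Følner sequence and their asymptotic invariance -/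

section FolnerMeasure

open scoped symmDiff

variable {G : Type*} [CommGroup G] [TopologicalSpace G] [MeasurableSpace G]

/-- The normalised restriction of `μ` to `B n`. -/
noncomputable def folnerMeasure (μ : Measure G) (B : ℕ → Set G) (n : ℕ) : Measure G :=
  ProbabilityTheory.cond μ (B n)

/-- The relative size of the difference of `B n` and its translate by `v`. -/
noncomputable def folnerDefect (μ : Measure G) (B : ℕ → Set G) (n : ℕ) (v : G) : ℝ :=
  (μ ((v • B n) ∆ B n) / μ (B n)).toReal

variable {μ : Measure G} {B : ℕ → Set G}

namespace IsFolnerSequence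

lemma tendsto_folnerDefect (hB : IsFolnerSequence μ B) (v : G) :
    Tendsto (fun n => folnerDefect μ B n v) atTop (𝓝 0) := by
  have h := (ENNReal.tendsto_toReal ENNReal.zero_ne_top).comp
    (hB.foelner.tendsto_meas_smul_symmDiff v)
  simpa [folnerDefect, Function.comp_def] using h

variable [IsTopologicalGroup G] [BorelSpace G] [μ.IsHaarMeasure]

lemma measure_ne_top (hB : IsFolnerSequence μ B) (n : ℕ) : μ (B n) ≠ ⊤ :=
  ((measure_mono subset_closure).trans_lt (hB.relativelyCompact n).measure_lt_top).ne

lemma measure_ne_zero (hB : IsFolnerSequence μ B) (n : ℕ) : μ (B n) ≠ 0 :=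
  ((hB.isOpen n).measure_pos μ (hB.nonempty n)).ne'

lemma isProbabilityMeasure (hB : IsFolnerSequence μ B) (n : ℕ) :
    IsProbabilityMeasure (folnerMeasure μ B n) :=
  ProbabilityTheory.cond_isProbabilityMeasure_of_finite (hB.measure_ne_zero n) (hB.measure_ne_top n)

end IsFolnerSequence

variable {E : Type*} [NormedAddCommGroup E] [NormedSpace ℝ E]

lemma integral_folnerMeasure (n : ℕ) (f : G → E) :
    ∫ u, f u ∂(folnerMeasure μ B n) = (μ.real (B n))⁻¹ • ∫ u in B n, f u ∂μ := by
  rw [folnerMeasure, ProbabilityTheory.cond, integral_smul_measure, ENNReal.toReal_inv]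
  rfl

variable [IsTopologicalGroup G] [BorelSpace G] [μ.IsHaarMeasure]

lemma setIntegral_smul_eq (s : G) (A : Set G) (f : G → E) :
    ∫ u in s • A, f u ∂μ = ∫ u in A, f (s * u) ∂μ := by
  have := (measurePreserving_mul_left μ s).setIntegral_image_emb
    (Homeomorph.mulLeft s).measurableEmbedding f A
  simpa [← Set.image_smul] using this

lemma windowMean_eq_integral (n : ℕ) (s : G) (f : G → E) :
    windowMean μ B n s f = ∫ u, f (s * u) ∂(folnerMeasure μ B n) := by
  rw [integral_folnerMeasure, windowMean, setIntegral_smul_eq]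

lemma windowMean_one (n : ℕ) (f : G → E) :
    windowMean μ B n 1 f = ∫ u, f u ∂(folnerMeasure μ B n) := by
  simp [windowMean_eq_integral]

/-- Translating a bounded function changes its mean by at most its bound times the Følner
defect. -/
lemma norm_integral_translate_sub_le (hB : IsFolnerSequence μ B) (n : ℕ) (v : G) {f : G → E}
    (hf : AEStronglyMeasurable f μ) {C : ℝ} (hC : ∀ u, ‖f u‖ ≤ C) :
    ‖∫ u, f (v * u) ∂(folnerMeasure μ B n) - ∫ u, f u ∂(folnerMeasure μ B n)‖
      ≤ C * folnerDefect μ B n v := by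
  have hA : MeasurableSet (B n) := (hB.isOpen n).measurableSet
  have hA' : MeasurableSet (v • B n) := ((hB.isOpen n).smul v).measurableSet
  have hfin := hB.measure_ne_top n
  have hfin' : μ (v • B n) ≠ ⊤ := by rwa [measure_smul]
  have hint : ∀ A : Set G, μ A ≠ ⊤ → IntegrableOn f A μ := fun A hA =>
    Measure.integrableOn_of_bounded (M := C) hA hf (Eventually.of_forall hC)
  rw [integral_folnerMeasure, integral_folnerMeasure, ← setIntegral_smul_eq, ← smul_sub]
  have e1 : ∫ u in v • B n, f u ∂μ = ∫ u in v • B n \ B n, f u ∂μ + ∫ u in v • B n ∩ B n, f u ∂μ := by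
    rw [add_comm, integral_inter_add_sdiff hA (hint _ hfin')]
  have e2 : ∫ u in B n, f u ∂μ = ∫ u in B n \ v • B n, f u ∂μ + ∫ u in v • B n ∩ B n, f u ∂μ := by
    rw [add_comm, Set.inter_comm, integral_inter_add_sdiff hA' (hint _ hfin)]
  have hd1 : μ (v • B n \ B n) < ⊤ := (measure_mono Set.sdiff_subset).trans_lt hfin'.lt_top
  have hd2 : μ (B n \ v • B n) < ⊤ := (measure_mono Set.sdiff_subset).trans_lt hfin.lt_top
  have hs : μ.real ((v • B n) ∆ B n) = μ.real (v • B n \ B n) + μ.real (B n \ v • B n) := by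
    rw [Set.symmDiff_def]
    exact measureReal_union disjoint_sdiff_sdiff (hA.diff hA') hd1.ne hd2.ne
  have hle : ‖∫ u in v • B n, f u ∂μ - ∫ u in B n, f u ∂μ‖ ≤ C * μ.real ((v • B n) ∆ B n) := by
    rw [e1, e2, add_sub_add_right_eq_sub, hs, mul_add]
    exact (norm_sub_le _ _).trans (add_le_add
      (norm_setIntegral_le_of_norm_le_const hd1 fun x _ => hC x)
      (norm_setIntegral_le_of_norm_le_const hd2 fun x _ => hC x))
  rw [norm_smul, norm_inv, Real.norm_of_nonneg measureReal_nonneg, folnerDefect, ENNReal.toReal_div]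
  calc _ ≤ (μ.real (B n))⁻¹ * (C * μ.real ((v • B n) ∆ B n)) := by gcongr
    _ = _ := by simp only [Measure.real]; ring

/-- Asymptotic invariance of the means along a Følner sequence. -/
lemma tendsto_integral_translate_sub (hB : IsFolnerSequence μ B) (v : G) {f : ℕ → G → E}
    (hf : ∀ n, AEStronglyMeasurable (f n) μ) {C : ℝ} (hC : ∀ n u, ‖f n u‖ ≤ C)
    {l : Filter ℕ} {ν : ℕ → ℕ} (hν : Tendsto ν l atTop) :
    Tendsto (fun k => ∫ u, f k (v * u) ∂(folnerMeasure μ B (ν k))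
      - ∫ u, f k u ∂(folnerMeasure μ B (ν k))) l (𝓝 0) := by
  refine squeeze_zero_norm (fun k => norm_integral_translate_sub_le hB (ν k) v (hf k) (hC k)) ?_
  simpa using ((hB.tendsto_folnerDefect v).comp hν).const_mul C

end FolnerMeasure

/-! ### Averages of continuous functions over orbit pieces -/

section OrbitAverage

variable {G Y : Type*} [CommGroup G] [TopologicalSpace G]
  [TopologicalSpace Y] [MulAction G Y] [ContinuousSMul G Y]

/-- The translate `y ↦ F (u • y)` of a continuous function. -/
def actComp {E : Type*} [TopologicalSpace E] (u : G) (F : C(Y, E)) : C(Y, E) :=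
  ⟨fun y => F (u • y), F.continuous.comp (continuous_const_smul u)⟩

@[simp] lemma actComp_apply {E : Type*} [TopologicalSpace E] (u : G) (F : C(Y, E)) (y : Y) :
    actComp u F y = F (u • y) := rfl

lemma continuous_actComp {E : Type*} [TopologicalSpace E] (F : C(Y, E)) :
    Continuous fun u : G => actComp u F :=
  ContinuousMap.continuous_of_continuous_uncurry _
    (F.continuous.comp (continuous_fst.smul continuous_snd))

lemma continuous_orbit {E : Type*} [TopologicalSpace E] (F : C(Y, E)) (y : Y) :
    Continuous fun u : G => F (u • y) :=
  F.continuous.comp (continuous_id.smul continuous_const)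

variable [CompactSpace Y] {E : Type*} [NormedAddCommGroup E]

lemma norm_actComp_le (u : G) (F : C(Y, E)) : ‖actComp u F‖ ≤ ‖F‖ :=
  (ContinuousMap.norm_le _ (norm_nonneg _)).2 fun y => F.norm_coe_le_norm (u • y)

variable [NormedSpace ℝ E] [MeasurableSpace G]

/-- The average `y ↦ |B_n|⁻¹ ∫_{B_n} F(uy) du` of a continuous function over orbit pieces. -/
noncomputable def orbitAverage (μ : Measure G) (B : ℕ → Set G) (n : ℕ) (F : C(Y, E)) : C(Y, E) :=
  ∫ u, actComp u F ∂(folnerMeasure μ B n)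

variable [T2Space Y] [SecondCountableTopology Y] [IsTopologicalGroup G] [BorelSpace G] {μ : Measure G}
  {B : ℕ → Set G} [SecondCountableTopology E]

lemma integrable_actComp (ν : Measure G) [IsFiniteMeasure ν] (F : C(Y, E)) :
    Integrable (fun u : G => actComp u F) ν :=
  Integrable.of_bound (continuous_actComp F).aestronglyMeasurable ‖F‖
    (Eventually.of_forall fun u => norm_actComp_le u F)

lemma integrable_orbit (ν : Measure G) [IsFiniteMeasure ν] (F : C(Y, E)) (y : Y) :
    Integrable (fun u : G => F (u • y)) ν :=
  Integrable.of_bound (continuous_orbit F y).aestronglyMeasurable ‖F‖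
    (Eventually.of_forall fun _ => F.norm_coe_le_norm _)

variable [μ.IsHaarMeasure] [CompleteSpace E]

/-- The average is a Bochner integral in `C(Y, E)`, so continuous linear maps pass through it.
Evaluation at a point, integration against an invariant measure and averaging at another level are
all handled this way. -/
lemma map_orbitAverage (hB : IsFolnerSequence μ B) {E' : Type*} [NormedAddCommGroup E']
    [NormedSpace ℝ E'] [CompleteSpace E'] (Λ : C(Y, E) →L[ℝ] E') (n : ℕ) (F : C(Y, E)) :
    Λ (orbitAverage μ B n F) = ∫ u, Λ (actComp u F) ∂(folnerMeasure μ B n) :=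
  have := hB.isProbabilityMeasure n
  (Λ.integral_comp_comm (integrable_actComp _ F)).symm

lemma orbitAverage_apply (hB : IsFolnerSequence μ B) (n : ℕ) (F : C(Y, E)) (y : Y) :
    orbitAverage μ B n F y = ∫ u, F (u • y) ∂(folnerMeasure μ B n) :=
  map_orbitAverage hB (ContinuousMap.evalCLM ℝ y) n F

/-- As `G` is abelian, shifting the window amounts to moving the base point; suprema over windows
become suprema over orbits. -/
lemma windowMean_orbit (hB : IsFolnerSequence μ B) (n : ℕ) (s : G) (F : C(Y, E)) (y : Y) :
    windowMean μ B n s (fun u => F (u • y)) = orbitAverage μ B n F (s • y) := by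
  rw [windowMean_eq_integral, orbitAverage_apply hB]
  simp [mul_comm s, mul_smul]

lemma norm_orbitAverage_le (hB : IsFolnerSequence μ B) (n : ℕ) (F : C(Y, E)) :
    ‖orbitAverage μ B n F‖ ≤ ‖F‖ := by
  have := hB.isProbabilityMeasure n
  simpa [orbitAverage] using norm_integral_le_of_norm_le_const (μ := folnerMeasure μ B n)
    (Eventually.of_forall fun u => norm_actComp_le u F)

/-- Averages of `F` and of `orbitAverage F` along an orbit agree asymptotically. -/
lemma tendsto_orbitAverage_sub_orbitAverage (hB : IsFolnerSequence μ B) (N : ℕ) (F : C(Y, ℝ))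
    (y : Y) : Tendsto (fun n => orbitAverage μ B n (orbitAverage μ B N F) y
      - orbitAverage μ B n F y) atTop (𝓝 0) := by
  have := hB.isProbabilityMeasure N
  -- Averaging at level `n` is a functional that can be moved inside the integral defining the
  -- level-`N` average. What remains is a Følner difference for each `v`, integrated over the fixed
  -- window `B N`.
  let Λ (n : ℕ) : C(Y, ℝ) →L[ℝ] ℝ :=
    LinearMap.mkContinuous
      { toFun := fun F => orbitAverage μ B n F y
        map_add' := fun F F' => by
          have := hB.isProbabilityMeasure n
          simp only [orbitAverage_apply hB, ContinuousMap.add_apply]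
          exact integral_add (integrable_orbit _ F y) (integrable_orbit _ F' y)
        map_smul' := fun c F => by
          simp only [orbitAverage_apply hB, ContinuousMap.smul_apply, integral_smul]
          rfl } 1 fun F => by
            simpa using (ContinuousMap.norm_coe_le_norm _ y).trans (norm_orbitAverage_le hB n F)
  have hΛ (n : ℕ) (F : C(Y, ℝ)) : Λ n F = orbitAverage μ B n F y := rfl
  have hb (n : ℕ) (F : C(Y, ℝ)) : ‖Λ n F‖ ≤ ‖F‖ :=
    (ContinuousMap.norm_coe_le_norm _ y).trans (norm_orbitAverage_le hB n F)
  have key (n : ℕ) : orbitAverage μ B n (orbitAverage μ B N F) y - orbitAverage μ B n F y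
      = ∫ v, (Λ n (actComp v F) - Λ n F) ∂(folnerMeasure μ B N) := by
    rw [integral_sub ((Λ n).integrable_comp (integrable_actComp _ F)) (integrable_const _),
      ← map_orbitAverage hB (Λ n)]
    simp [hΛ]
  simp_rw [key]
  rw [← integral_zero G ℝ (μ := folnerMeasure μ B N)]
  refine tendsto_integral_of_dominated_convergence (fun _ => 2 * ‖F‖) (fun n => ?_)
    (integrable_const _) (fun n => Eventually.of_forall fun v => ?_)
    (Eventually.of_forall fun v => ?_)
  · exact (((Λ n).continuous.comp (continuous_actComp F)).sub
      continuous_const).aestronglyMeasurable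
  · have h1 := norm_sub_le (Λ n (actComp v F)) (Λ n F)
    have h2 := hb n (actComp v F)
    have h3 := hb n F
    have h4 := norm_actComp_le v F
    linarith
  · simp_rw [hΛ, orbitAverage_apply hB, actComp_apply]
    have := tendsto_integral_translate_sub hB v (f := fun _ u => F (u • y)) (C := ‖F‖)
      (fun _ => (continuous_orbit F y).aestronglyMeasurable) (fun _ u => F.norm_coe_le_norm _)
      tendsto_id
    simpa [mul_smul] using this

/-- This stands in for monotonicity in the level: a level-`n` average of level-`N` averages is at
most `ε`, and it asymptotically equals the level-`n` average of `F` itself. -/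
lemma eventually_orbitAverage_lt (hB : IsFolnerSequence μ B) {N : ℕ} {F : C(Y, ℝ)} {y : Y} {ε : ℝ}
    (h : ∀ s : G, orbitAverage μ B N F (s • y) ≤ ε) {ε' : ℝ} (hε : ε < ε') :
    ∀ᶠ n in atTop, orbitAverage μ B n F y < ε' := by
  filter_upwards [(tendsto_orbitAverage_sub_orbitAverage hB N F y).eventually
    (lt_mem_nhds (neg_lt_zero.2 (sub_pos.2 hε)))] with n hn
  have := hB.isProbabilityMeasure n
  have h1 : orbitAverage μ B n (orbitAverage μ B N F) y ≤ ε := by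
    rw [orbitAverage_apply hB]
    simpa using integral_mono (integrable_orbit (folnerMeasure μ B n) (orbitAverage μ B N F) y)
      (integrable_const ε) fun u => h u
  linarith

/-- An invariant measure does not distinguish a function from its averages. -/
lemma integral_orbitAverage (hB : IsFolnerSequence μ B) [MeasurableSpace Y] [BorelSpace Y]
    (M : Measure Y) [IsProbabilityMeasure M] [SMulInvariantMeasure G Y M] (n : ℕ) (F : C(Y, E)) :
    ∫ y, orbitAverage μ B n F y ∂M = ∫ y, F y ∂M := by
  have := hB.isProbabilityMeasure n
  let Λ : C(Y, E) →L[ℝ] E := LinearMap.mkContinuous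
      { toFun := fun F => ∫ y, F y ∂M
        map_add' := fun F F' => integral_add
          (F.continuous.integrable_of_hasCompactSupport (HasCompactSupport.of_compactSpace _))
          (F'.continuous.integrable_of_hasCompactSupport (HasCompactSupport.of_compactSpace _))
        map_smul' := fun c F => integral_smul c _ } 1 fun F => by
          simpa using norm_integral_le_of_norm_le_const (μ := M)
            (Eventually.of_forall fun y => F.norm_coe_le_norm y)
  have h := map_orbitAverage hB Λ n F
  have hΛ (u : G) : Λ (actComp u F) = ∫ y, F y ∂M := integral_smul_eq_self (⇑F) (g := u)
  simp_rw [hΛ] at h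
  exact h.trans (by simp)

end OrbitAverage

/-! ### Invariant measures as limits of orbit averages -/

section InvariantMeasures

variable {G Y : Type*} [CommGroup G] [TopologicalSpace G] [MetricSpace Y] [CompactSpace Y]
  [MeasurableSpace Y] [BorelSpace Y] [MulAction G Y] [ContinuousSMul G Y]

lemma ContinuousMap.integrable_of_compactSpace {E : Type*} [NormedAddCommGroup E]
    (F : C(Y, E)) (M : Measure Y) [IsFiniteMeasure M] : Integrable F M :=
  F.continuous.integrable_of_hasCompactSupport (HasCompactSupport.of_compactSpace _)

lemma measure_eq_of_forall_integral_eq {M M' : Measure Y} [IsFiniteMeasure M] [IsFiniteMeasure M']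
    (h : ∀ F : C(Y, ℝ), ∫ y, F y ∂M = ∫ y, F y ∂M') : M = M' :=
  ext_of_forall_integral_eq_of_IsFiniteMeasure fun F => h F.toContinuousMap

lemma smulInvariantMeasure_of_forall_integral_eq {M : Measure Y} [IsFiniteMeasure M]
    (h : ∀ (v : G) (F : C(Y, ℝ)), ∫ y, F (v • y) ∂M = ∫ y, F y ∂M) :
    SMulInvariantMeasure G Y M := by
  refine ⟨fun v s hs => ?_⟩
  have hm : Measurable fun y : Y => v • y := (continuous_const_smul v).measurable
  have : Measure.map (fun y : Y => v • y) M = M := by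
    have : IsFiniteMeasure (Measure.map (fun y : Y => v • y) M) := inferInstance
    refine measure_eq_of_forall_integral_eq fun F => ?_
    rw [integral_map hm.aemeasurable F.continuous.aestronglyMeasurable, h]
  conv_rhs => rw [← this]
  rw [Measure.map_apply hm hs]

variable [MeasurableSpace G] [IsTopologicalGroup G] [BorelSpace G] {μ : Measure G}
  [μ.IsHaarMeasure] {B : ℕ → Set G}

/-- Limits of averages along orbit pieces are given by invariant probability measures. -/
lemma exists_invariant_limit (hB : IsFolnerSequence μ B) {ν : ℕ → ℕ} {U : Ultrafilter ℕ}
    (hν : Tendsto ν U atTop) (y : ℕ → Y) :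
    ∃ M : Measure Y, IsProbabilityMeasure M ∧ SMulInvariantMeasure G Y M ∧ ∀ F : C(Y, ℝ),
      Tendsto (fun k => orbitAverage μ B (ν k) F (y k)) U (𝓝 (∫ z, F z ∂M)) := by
  have := hB.isProbabilityMeasure
  have hm (k : ℕ) : Measurable fun u : G => u • y k :=
    (continuous_id.smul continuous_const).measurable
  let P (k : ℕ) : ProbabilityMeasure Y :=
    ⟨(folnerMeasure μ B (ν k)).map fun u => u • y k,
      Measure.isProbabilityMeasure_map (hm k).aemeasurable⟩
  -- Probability measures on a compact metric space form a compact space, so the ultrafilter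
  -- converges and no subsequence is needed.
  obtain ⟨M, hM⟩ : ∃ M, Tendsto P U (𝓝 M) := ⟨(U.map P).lim, (U.map P).le_nhds_lim⟩
  have key (F : C(Y, ℝ)) : Tendsto (fun k => orbitAverage μ B (ν k) F (y k)) U
      (𝓝 (∫ z, F z ∂(M : Measure Y))) := by
    have h := ProbabilityMeasure.tendsto_iff_forall_integral_tendsto.1 hM
      (BoundedContinuousFunction.mkOfCompact F)
    refine h.congr fun k => ?_
    rw [orbitAverage_apply hB]
    exact integral_map (hm k).aemeasurable F.continuous.aestronglyMeasurable
  refine ⟨M, inferInstance, smulInvariantMeasure_of_forall_integral_eq fun v F => ?_, key⟩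
  have h1 := (key (actComp v F)).sub (key F)
  have h2 := tendsto_integral_translate_sub hB v (f := fun k u => F (u • y k)) (C := ‖F‖)
      (fun k => (continuous_orbit F (y k)).aestronglyMeasurable)
      (fun _ u => F.norm_coe_le_norm _) hν
  simp only [orbitAverage_apply hB, actComp_apply, ← mul_smul] at h1
  exact sub_eq_zero.1 (tendsto_nhds_unique h1 h2)

lemma exists_invariant_measure (hB : IsFolnerSequence μ B) [Nonempty Y] :
    ∃ M : Measure Y, IsProbabilityMeasure M ∧ SMulInvariantMeasure G Y M := by
  obtain ⟨y⟩ := ‹Nonempty Y›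
  obtain ⟨M, h1, h2, -⟩ := exists_invariant_limit hB (ν := id) (U := hyperfilter ℕ)
    Nat.hyperfilter_le_atTop fun _ => y
  exact ⟨M, h1, h2⟩

/-- Uniform convergence of the averages in uniquely ergodic systems. -/
lemma IsUniqueInvariantMeasure.eventually_orbitAverage (hB : IsFolnerSequence μ B) {m : Measure Y}
    (hm : IsUniqueInvariantMeasure G m) (F : C(Y, ℝ)) {ε : ℝ} (hε : 0 < ε) :
    ∀ᶠ n in atTop, ∀ y, |orbitAverage μ B n F y - ∫ z, F z ∂m| < ε := by
  -- If uniformity failed, there would be levels `ν k ≥ k` and points `y k` with deviation at least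
  -- `ε`; the limit measure is invariant, hence equal to `m`, yet integrates `F` differently.
  by_contra hcon
  rw [not_eventually, frequently_atTop] at hcon
  choose ν hν hν' using hcon
  push Not at hν'
  choose y hy using hν'
  have hν2 : Tendsto ν (hyperfilter ℕ) atTop :=
    (tendsto_atTop_mono hν tendsto_id).mono_left Nat.hyperfilter_le_atTop
  obtain ⟨M, h1, h2, h3⟩ := exists_invariant_limit hB hν2 y
  obtain rfl := hm.2 M h1 h2
  have h4 := ((h3 F).sub_const (∫ z, F z ∂M)).abs
  rw [sub_self, abs_zero] at h4
  exact absurd (ge_of_tendsto h4 (Eventually.of_forall hy)) (not_le.2 hε)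

end InvariantMeasures

/-! ### The pseudometrics `D_n`, mean equicontinuity and unique ergodicity -/

section AveragedDist

variable {G X : Type*} [CommGroup G] [TopologicalSpace G] [IsTopologicalGroup G]
  [MeasurableSpace G] [BorelSpace G] {μ : Measure G} [μ.IsHaarMeasure] {B : ℕ → Set G}
  [MetricSpace X] [CompactSpace X] [MulAction G X] [ContinuousSMul G X]

variable (X) in
/-- The metric as a continuous function on `X × X`. -/
def distMap : C(X × X, ℝ) := ⟨fun z => dist z.1 z.2, continuous_dist⟩

@[simp] lemma distMap_apply (x y : X) : distMap X (x, y) = dist x y := rfl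

lemma windowMean_dist (hB : IsFolnerSequence μ B) (n : ℕ) (s : G) (x y : X) :
    windowMean μ B n s (fun t => dist (t • x) (t • y))
      = orbitAverage μ B n (distMap X) (s • (x, y)) :=
  windowMean_orbit hB n s (distMap X) (x, y)

lemma bddAbove_range_orbitAverage (n : ℕ) (F : C(X × X, ℝ)) (z : X × X) :
    BddAbove (Set.range fun s : G => orbitAverage μ B n F (s • z)) :=
  ⟨‖orbitAverage μ B n F‖, by
    rintro _ ⟨s, rfl⟩
    exact (le_abs_self _).trans ((orbitAverage μ B n F).norm_coe_le_norm _)⟩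

lemma averagedDist_eq (hB : IsFolnerSequence μ B) (n : ℕ) (x y : X) :
    averagedDist μ B n x y = ⨆ s : G, orbitAverage μ B n (distMap X) (s • (x, y)) := by
  simp_rw [averagedDist, uniformMean, windowMean_dist hB]

lemma averagedDist_le_iff (hB : IsFolnerSequence μ B) {n : ℕ} {x y : X} {c : ℝ} :
    averagedDist μ B n x y ≤ c ↔ ∀ s : G, orbitAverage μ B n (distMap X) (s • (x, y)) ≤ c := by
  rw [averagedDist_eq hB, ciSup_le_iff (bddAbove_range_orbitAverage n _ _)]

lemma orbitAverage_dist_le_averagedDist (hB : IsFolnerSequence μ B) (n : ℕ) (s : G) (x y : X) :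
    orbitAverage μ B n (distMap X) (s • (x, y)) ≤ averagedDist μ B n x y :=
  (averagedDist_le_iff hB).1 le_rfl s

lemma orbitAverage_dist_triangle (hB : IsFolnerSequence μ B) (n : ℕ) (x y z : X) :
    orbitAverage μ B n (distMap X) (x, z) ≤
      orbitAverage μ B n (distMap X) (x, y) + orbitAverage μ B n (distMap X) (y, z) := by
  have := hB.isProbabilityMeasure n
  simp_rw [orbitAverage_apply hB]
  rw [← integral_add (integrable_orbit _ _ _) (integrable_orbit _ _ _)]
  exact integral_mono (integrable_orbit _ _ _)
    ((integrable_orbit _ _ _).add (integrable_orbit _ _ _)) fun u => dist_triangle _ _ _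

lemma orbitAverage_dist_comm (hB : IsFolnerSequence μ B) (n : ℕ) (x y : X) :
    orbitAverage μ B n (distMap X) (x, y) = orbitAverage μ B n (distMap X) (y, x) := by
  simp_rw [orbitAverage_apply hB]
  exact integral_congr_ae (Eventually.of_forall fun u => dist_comm _ _)

lemma averagedDist_triangle (hB : IsFolnerSequence μ B) (n : ℕ) (x y z : X) :
    averagedDist μ B n x z ≤ averagedDist μ B n x y + averagedDist μ B n y z :=
  (averagedDist_le_iff hB).2 fun s => (orbitAverage_dist_triangle hB n _ (s • y) _).trans
    (add_le_add (orbitAverage_dist_le_averagedDist hB n s x y)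
      (orbitAverage_dist_le_averagedDist hB n s y z))

lemma averagedDist_comm (n : ℕ) (x y : X) :
    averagedDist μ B n x y = averagedDist μ B n y x := by
  simp_rw [averagedDist, dist_comm]

lemma averagedDist_smul (hB : IsFolnerSequence μ B) (n : ℕ) (g : G) (x y : X) :
    averagedDist μ B n (g • x) (g • y) = averagedDist μ B n x y := by
  simp_rw [averagedDist_eq hB]
  exact (Equiv.mulRight g).iSup_congr fun s => by simp [mul_smul]

/-- A supremum of continuous functions is lower semicontinuous; this is what lets bounds on the
orbit of `p` pass to its closure. -/
lemma isClosed_averagedDist_le (hB : IsFolnerSequence μ B) (n : ℕ) (c : ℝ) :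
    IsClosed {z : X × X | averagedDist μ B n z.1 z.2 ≤ c} := by
  simp_rw [averagedDist_le_iff hB, Set.ofPred_forall]
  exact isClosed_iInter fun s => isClosed_le
    ((orbitAverage μ B n (distMap X)).continuous.comp (continuous_const_smul s)) continuous_const

variable {p : X}

/-- All points are close to a compact part of the orbit of `p`. -/
lemma WeylAlmostPeriodicPoint.exists_isCompact (hB : IsFolnerSequence μ B)
    (hp : Dense (MulAction.orbit G p)) (h : WeylAlmostPeriodicPoint μ B p) {ε : ℝ} (hε : 0 < ε) :
    ∃ (N : ℕ) (K : Set G), IsCompact K ∧ ∀ x : X, ∃ k ∈ K, averagedDist μ B N x (k • p) ≤ ε := by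
  obtain ⟨N, K, hK, hA⟩ := h ε hε
  refine ⟨N, K, hK, ?_⟩
  have : CompactSpace K := isCompact_iff_compactSpace.1 hK
  -- Projection along the compact factor `K` is closed, so the points within `ε` of `K • p` form a
  -- closed set. It remains to see that it contains the dense orbit.
  have hcl : IsClosed (Prod.fst '' {z : X × K | averagedDist μ B N z.1 ((z.2 : G) • p) ≤ ε}) := by
    refine isClosedMap_fst_of_compactSpace _ ((isClosed_averagedDist_le hB N ε).preimage
      (f := fun z : X × K => (z.1, (z.2 : G) • p)) ?_)
    fun_prop
  intro x
  have hx : x ∈ Prod.fst '' {z : X × K | averagedDist μ B N z.1 ((z.2 : G) • p) ≤ ε} := by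
    refine hcl.closure_subset_iff.2 ?_ (hp x)
    rintro _ ⟨g, rfl⟩
    -- Writing the orbit point as `(a * k) • p`, invariance reduces its distance to `k • p` to that
    -- between `a • p` and `p`.
    obtain ⟨a, ha, k, hk, rfl⟩ : ∃ a ∈ {t : G | averagedDist μ B N p (t • p) < ε},
        g ∈ a • K := by
      have := hA ▸ Set.mem_univ g
      simpa using this
    refine ⟨((a * k) • p, ⟨k, hk⟩), ?_, rfl⟩
    change averagedDist μ B N ((a * k) • p) (k • p) ≤ ε
    rw [mul_comm, mul_smul, averagedDist_smul hB, averagedDist_comm]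
    exact le_of_lt ha
  obtain ⟨⟨_, k⟩, hk, rfl⟩ := hx
  exact ⟨k, k.2, hk⟩

/-- Since `k` and `k'` commute with all translations involved, every value of the integrand is a
distance `dist (k • z) (k' • z)`. -/
lemma averagedDist_smul_smul_le (hB : IsFolnerSequence μ B) (n : ℕ) {k k' : G} {ε : ℝ}
    (h : ∀ x : X, dist (k • x) (k' • x) ≤ ε) (x : X) :
    averagedDist μ B n (k • x) (k' • x) ≤ ε := by
  have := hB.isProbabilityMeasure n
  refine (averagedDist_le_iff hB).2 fun s => ?_
  rw [orbitAverage_apply hB]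
  have := integral_mono (integrable_orbit (folnerMeasure μ B n) (distMap X) (s • (k • x, k' • x)))
    (integrable_const ε) fun u => by
      change dist (u • s • k • x) (u • s • k' • x) ≤ ε
      rw [smul_comm s k, smul_comm u k, smul_comm s k', smul_comm u k']
      exact h _
  simpa using this

/-- The compact set `K` acts through a compact subset of `C(X, X)`. A finite uniform net there
replaces `K • p` by finitely many points. -/
lemma WeylAlmostPeriodicPoint.exists_finite (hB : IsFolnerSequence μ B)
    (hp : Dense (MulAction.orbit G p)) (h : WeylAlmostPeriodicPoint μ B p) {ε : ℝ} (hε : 0 < ε) :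
    ∃ (N : ℕ) (Q : Set X), Q.Finite ∧ ∀ x : X, ∃ q ∈ Q, averagedDist μ B N x q ≤ ε := by
  obtain ⟨N, K, hK, hA⟩ := h.exists_isCompact hB hp (half_pos hε)
  have hKc : IsCompact ((fun u : G => actComp u (ContinuousMap.id X)) '' K) :=
    hK.image (continuous_actComp _)
  obtain ⟨T, hTK, hT, hcov⟩ := totallyBounded_iff_subset.1 hKc.totallyBounded _
    (Metric.dist_mem_uniformity (half_pos hε))
  refine ⟨N, (fun f : C(X, X) => f p) '' T, hT.image _, fun x => ?_⟩
  obtain ⟨k, hk, hxk⟩ := hA x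
  obtain ⟨f, hf, hkf⟩ := Set.mem_iUnion₂.1 (hcov ⟨k, hk, rfl⟩)
  obtain ⟨k', -, rfl⟩ := hTK hf
  refine ⟨k' • p, ⟨_, hf, rfl⟩, (averagedDist_triangle hB N _ (k • p) _).trans ?_⟩
  have := averagedDist_smul_smul_le hB N (k := k) (k' := k') (ε := ε / 2) (fun z =>
    (ContinuousMap.dist_apply_le_dist z).trans (le_of_lt hkf)) p
  linarith

/-- Mean equicontinuity. -/
lemma WeylAlmostPeriodicPoint.eventually_averagedDist_le (hB : IsFolnerSequence μ B)
    (hp : Dense (MulAction.orbit G p)) (h : WeylAlmostPeriodicPoint μ B p) {ε : ℝ} (hε : 0 < ε) :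
    ∃ N : ℕ, ∀ x : X, ∀ᶠ y in 𝓝 x, averagedDist μ B N x y ≤ ε := by
  obtain ⟨N, Q, hQ, hA⟩ := h.exists_finite hB hp (half_pos hε)
  refine ⟨N, fun x => ?_⟩
  have hcl (q : X) : IsClosed {y | averagedDist μ B N y q ≤ ε / 2} :=
    (isClosed_averagedDist_le hB N (ε / 2)).preimage (by fun_prop : Continuous fun y : X => (y, q))
  -- The closed `D_N`-balls around the net points are finite in number, so near `x` a point lies
  -- only in balls that contain `x` too. A centre serving `y` then also serves `x`.
  have : ∀ᶠ y in 𝓝 x, ∀ q ∈ Q, averagedDist μ B N y q ≤ ε / 2 →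
      averagedDist μ B N x q ≤ ε / 2 := by
    refine (eventually_all_finite hQ).2 fun q _ => ?_
    by_cases hx : averagedDist μ B N x q ≤ ε / 2
    · exact Eventually.of_forall fun _ _ => hx
    · filter_upwards [(hcl q).isOpen_compl.mem_nhds hx] with y hy hy'
      exact absurd hy' hy
  filter_upwards [this] with y hy
  obtain ⟨q, hq, hyq⟩ := hA y
  have h1 := averagedDist_triangle hB N x q y
  have h2 := hy q hq hyq
  rw [averagedDist_comm N q y] at h1
  linarith

/-- A continuous function on a compact metric space is Lipschitz up to a small error. -/
lemma exists_dist_le_add_mul_dist {E : Type*} [NormedAddCommGroup E] (f : C(X, E)) {ε : ℝ}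
    (hε : 0 < ε) : ∃ C, 0 < C ∧ ∀ x y, dist (f x) (f y) ≤ ε + C * dist x y := by
  obtain ⟨δ, hδ, h⟩ := Metric.uniformContinuous_iff.1
    (CompactSpace.uniformContinuous_of_continuous f.continuous) ε hε
  -- At distance at least `δ` this slope already exceeds the oscillation bound `2 * ‖f‖`; the `+ 1`
  -- keeps the constant positive.
  refine ⟨(2 * ‖f‖ + 1) / δ, by positivity, fun x y => ?_⟩
  by_cases hxy : dist x y < δ
  · exact (h hxy).le.trans (le_add_of_nonneg_right (by positivity))
  · have h1 : dist (f x) (f y) ≤ 2 * ‖f‖ := by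
      have := dist_le_norm_add_norm (f x) (f y)
      have := f.norm_coe_le_norm x
      have := f.norm_coe_le_norm y
      linarith
    have h2 : 2 * ‖f‖ + 1 ≤ (2 * ‖f‖ + 1) / δ * dist x y := by
      rw [div_mul_eq_mul_div, le_div_iff₀ hδ]
      exact mul_le_mul_of_nonneg_left (not_lt.1 hxy) (by positivity)
    linarith

/-- The averages of a continuous function along two orbits differ at most by a small error plus
a multiple of the averaged distance. -/
lemma abs_orbitAverage_sub_le (hB : IsFolnerSequence μ B) {f : C(X, ℝ)} {ε C : ℝ}
    (h : ∀ x y, dist (f x) (f y) ≤ ε + C * dist x y) (n : ℕ) (x y : X) :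
    |orbitAverage μ B n f x - orbitAverage μ B n f y|
      ≤ ε + C * orbitAverage μ B n (distMap X) (x, y) := by
  have := hB.isProbabilityMeasure n
  simp_rw [orbitAverage_apply hB]
  rw [← integral_sub (integrable_orbit _ _ _) (integrable_orbit _ _ _), ← integral_const_mul]
  rw [← Real.norm_eq_abs]
  have hi := ((integrable_orbit (folnerMeasure μ B n) (distMap X) (x, y)).const_mul C)
  refine (norm_integral_le_of_norm_le ((integrable_const ε).add hi)
    (Eventually.of_forall fun u => h _ _)).trans_eq ?_
  rw [integral_add' (integrable_const ε) hi]
  simp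

/-- Some `k • p` is `D_N`-close to `x`, so the averages of `f` at `x` and at `k • p` are eventually
close; those at `k • p` and `p` agree asymptotically by the Følner property. -/
lemma WeylAlmostPeriodicPoint.tendsto_orbitAverage_sub (hB : IsFolnerSequence μ B)
    (hp : Dense (MulAction.orbit G p)) (h : WeylAlmostPeriodicPoint μ B p) (f : C(X, ℝ)) (x : X) :
    Tendsto (fun n => orbitAverage μ B n f x - orbitAverage μ B n f p) atTop (𝓝 0) := by
  rw [Metric.tendsto_nhds]
  intro ε hε
  obtain ⟨C, hC, hf⟩ := exists_dist_le_add_mul_dist f (by positivity : 0 < ε / 4)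
  obtain ⟨N, K, -, hA⟩ := h.exists_isCompact hB hp (by positivity : 0 < ε / (4 * C))
  obtain ⟨k, -, hk⟩ := hA x
  have h1 := eventually_orbitAverage_lt hB (y := (x, k • p)) (F := distMap X)
    (fun s => (orbitAverage_dist_le_averagedDist hB N s _ _).trans hk)
    (by gcongr; norm_num : ε / (4 * C) < ε / (2 * C))
  have h2 : Tendsto (fun n => orbitAverage μ B n f (k • p) - orbitAverage μ B n f p) atTop
      (𝓝 0) := by
    have := tendsto_integral_translate_sub hB k (f := fun _ u => f (u • p)) (C := ‖f‖)
      (fun _ => (continuous_orbit f p).aestronglyMeasurable) (fun _ u => f.norm_coe_le_norm _)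
      tendsto_id
    simp_rw [orbitAverage_apply hB]
    simpa [smul_smul, mul_comm] using this
  have h3 := Metric.tendsto_nhds.1 h2 (ε / 4) (by positivity)
  filter_upwards [h1, h3] with n h1 h3
  rw [Real.dist_eq, sub_zero] at h3 ⊢
  have h4 := abs_orbitAverage_sub_le hB hf n x (k • p)
  have h5 : C * orbitAverage μ B n (distMap X) (x, k • p) < ε / 2 := by
    calc _ < C * (ε / (2 * C)) := by gcongr
      _ = ε / 2 := by field_simp
  have h6 := abs_sub_le (orbitAverage μ B n f x) (orbitAverage μ B n f (k • p))
    (orbitAverage μ B n f p)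
  linarith

/-- Unique ergodicity of systems generated by a Weyl almost periodic point. -/
lemma WeylAlmostPeriodicPoint.isUniqueInvariantMeasure [MeasurableSpace X] [BorelSpace X]
    (hB : IsFolnerSequence μ B) (hp : Dense (MulAction.orbit G p))
    (h : WeylAlmostPeriodicPoint μ B p) {m : Measure X} [IsProbabilityMeasure m]
    [SMulInvariantMeasure G X m] : IsUniqueInvariantMeasure G m := by
  refine ⟨⟨inferInstance, inferInstance⟩, fun m' _ _ => ?_⟩
  -- An integral against an invariant measure equals the integral of the averages, and these are
  -- asymptotically the averages at `p`, whatever the measure.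
  have key (M : Measure X) (_ : IsProbabilityMeasure M) (_ : SMulInvariantMeasure G X M)
      (f : C(X, ℝ)) :
      Tendsto (fun n => ∫ x, f x ∂M - orbitAverage μ B n f p) atTop (𝓝 0) := by
    have h1 (n : ℕ) : ∫ x, f x ∂M - orbitAverage μ B n f p
        = ∫ x, (orbitAverage μ B n f x - orbitAverage μ B n f p) ∂M := by
      rw [integral_sub (ContinuousMap.integrable_of_compactSpace _ _) (integrable_const _),
        integral_orbitAverage hB]
      simp
    simp_rw [h1]
    rw [← integral_zero X ℝ (μ := M)]
    refine tendsto_integral_of_dominated_convergence (fun _ => 2 * ‖f‖) (fun n => ?_)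
      (integrable_const _) (fun n => Eventually.of_forall fun x => ?_)
      (Eventually.of_forall fun x => h.tendsto_orbitAverage_sub hB hp f x)
    · fun_prop
    · have h1 := norm_sub_le (orbitAverage μ B n f x) (orbitAverage μ B n f p)
      have h2 := (orbitAverage μ B n f).norm_coe_le_norm x
      have h3 := (orbitAverage μ B n f).norm_coe_le_norm p
      have h4 := norm_orbitAverage_le hB n f
      linarith
  refine measure_eq_of_forall_integral_eq fun f => ?_
  have h1 := (key m' inferInstance inferInstance f).sub (key m inferInstance inferInstance f)
  simp only [sub_sub_sub_cancel_right, sub_zero] at h1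
  exact sub_eq_zero.1 (tendsto_nhds_unique tendsto_const_nhds h1)

end AveragedDist

/-! ### The Besicovitch pseudometric -/

section MeanDist

variable {G X : Type*} [CommGroup G] [TopologicalSpace G] [IsTopologicalGroup G]
  [MeasurableSpace G] [BorelSpace G] {μ : Measure G} [μ.IsHaarMeasure] {B : ℕ → Set G}
  [MetricSpace X] [CompactSpace X] [MulAction G X] [ContinuousSMul G X]

/-- The Besicovitch pseudometric: the upper mean distance along orbits. -/
noncomputable def meanDist (μ : Measure G) (B : ℕ → Set G) (x y : X) : ℝ :=
  limsup (fun n => orbitAverage μ B n (distMap X) (x, y)) atTop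

lemma abs_orbitAverage_le (hB : IsFolnerSequence μ B) (n : ℕ) (F : C(X, ℝ)) (x : X) :
    |orbitAverage μ B n F x| ≤ ‖F‖ :=
  ((orbitAverage μ B n F).norm_coe_le_norm x).trans (norm_orbitAverage_le hB n F)

lemma limsup_lt_iff_of_abs_le {a : ℕ → ℝ} {C : ℝ} (ha : ∀ n, |a n| ≤ C) {c : ℝ} :
    limsup a atTop < c ↔ ∃ c' < c, ∀ᶠ n in atTop, a n ≤ c' := by
  have hb : IsBoundedUnder (· ≤ ·) atTop a := isBoundedUnder_of ⟨C, fun n => (abs_le.1 (ha n)).2⟩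
  have hcb : IsCoboundedUnder (· ≤ ·) atTop a :=
    (isBoundedUnder_of ⟨-C, fun n => (abs_le.1 (ha n)).1⟩ :
      IsBoundedUnder (· ≥ ·) atTop a).isCoboundedUnder_le
  refine ⟨fun h => ?_, fun ⟨c', hc', h⟩ => (limsup_le_of_le hcb h).trans_lt hc'⟩
  obtain ⟨c', h1, h2⟩ := exists_between h
  exact ⟨c', h2, (eventually_lt_of_limsup_lt h1 hb).mono fun _ => le_of_lt⟩

lemma meanDist_lt_iff (hB : IsFolnerSequence μ B) {x y : X} {c : ℝ} :
    meanDist μ B x y < c ↔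
      ∃ c' < c, ∀ᶠ n in atTop, orbitAverage μ B n (distMap X) (x, y) ≤ c' :=
  limsup_lt_iff_of_abs_le fun n =>
    ((orbitAverage μ B n (distMap X)).norm_coe_le_norm (x, y)).trans (norm_orbitAverage_le hB n _)

lemma meanDist_triangle (hB : IsFolnerSequence μ B) (x y z : X) :
    meanDist μ B x z ≤ meanDist μ B x y + meanDist μ B y z := by
  refine le_of_forall_pos_lt_add fun ε hε => (meanDist_lt_iff hB).2 ?_
  obtain ⟨a, ha, ha'⟩ := (meanDist_lt_iff hB).1 (lt_add_of_pos_right (meanDist μ B x y) (half_pos hε))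
  obtain ⟨b, hb, hb'⟩ := (meanDist_lt_iff hB).1 (lt_add_of_pos_right (meanDist μ B y z) (half_pos hε))
  refine ⟨a + b, by linarith, ?_⟩
  filter_upwards [ha', hb'] with n h1 h2
  exact (orbitAverage_dist_triangle hB n x y z).trans (add_le_add h1 h2)

lemma meanDist_comm (hB : IsFolnerSequence μ B) (x y : X) : meanDist μ B x y = meanDist μ B y x := by
  simp_rw [meanDist, orbitAverage_dist_comm hB _ x y]

/-- The bound holds at every level, so one pseudometric inherits estimates whose level depends on
the accuracy. -/
lemma meanDist_le_averagedDist (hB : IsFolnerSequence μ B) (N : ℕ) (x y : X) :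
    meanDist μ B x y ≤ averagedDist μ B N x y := by
  refine le_of_forall_gt fun c hc => (meanDist_lt_iff hB).2 ?_
  obtain ⟨c', h1, h2⟩ := exists_between hc
  exact ⟨c', h2, (eventually_orbitAverage_lt hB (y := (x, y))
    (fun s => orbitAverage_dist_le_averagedDist hB N s x y) h1).mono fun _ => le_of_lt⟩

lemma meanDist_smul (hB : IsFolnerSequence μ B) (g : G) (x y : X) :
    meanDist μ B (g • x) (g • y) = meanDist μ B x y := by
  have key (g : G) (x y : X) : meanDist μ B (g • x) (g • y) ≤ meanDist μ B x y := by
    refine le_of_forall_gt fun c hc => (meanDist_lt_iff hB).2 ?_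
    obtain ⟨c', h1, h2⟩ := (meanDist_lt_iff hB).1 hc
    have h3 := tendsto_integral_translate_sub hB g (f := fun _ u => distMap X (u • (x, y)))
      (C := ‖distMap X‖) (fun _ => (continuous_orbit (distMap X) (x, y)).aestronglyMeasurable)
      (fun _ u => (distMap X).norm_coe_le_norm _) tendsto_id
    refine ⟨(c' + c) / 2, by linarith, ?_⟩
    filter_upwards [h2, h3.eventually (gt_mem_nhds (by linarith : 0 < (c - c') / 2))] with n h4 h5
    rw [orbitAverage_apply hB] at h4 ⊢
    have h6 : ∀ u : G, distMap X (u • (g • x, g • y)) = distMap X ((g * u) • (x, y)) := by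
      intro u
      rw [mul_comm, mul_smul]
      rfl
    simp_rw [h6]
    simp only [id] at h5
    linarith
  refine le_antisymm (key g x y) ?_
  simpa using key g⁻¹ (g • x) (g • y)

/-- Mean equicontinuity makes points near `x` close to `x` for the pseudometric as well; the
triangle inequality gives joint continuity. -/
lemma WeylAlmostPeriodicPoint.continuous_meanDist (hB : IsFolnerSequence μ B) {p : X}
    (hp : Dense (MulAction.orbit G p)) (h : WeylAlmostPeriodicPoint μ B p) :
    Continuous fun z : X × X => meanDist μ B z.1 z.2 := by
  rw [continuous_iff_continuousAt]
  rintro ⟨x, y⟩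
  rw [ContinuousAt, Metric.tendsto_nhds]
  intro ε hε
  obtain ⟨N, hN⟩ := h.eventually_averagedDist_le hB hp (by positivity : 0 < ε / 3)
  rw [nhds_prod_eq]
  filter_upwards [(hN x).prod_mk (hN y)] with z hz
  have h1 := (meanDist_le_averagedDist hB N x z.1).trans hz.1
  have h2 := (meanDist_le_averagedDist hB N y z.2).trans hz.2
  have h3 := meanDist_triangle hB x z.1 y
  have h4 := meanDist_triangle hB z.1 z.2 y
  have h5 := meanDist_triangle hB z.1 x z.2
  have h6 := meanDist_triangle hB x y z.2
  rw [meanDist_comm hB z.2 y] at h4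
  rw [meanDist_comm hB z.1 x] at h5
  rw [Real.dist_eq, abs_lt]
  constructor <;> linarith

end MeanDist

/-! ### Simultaneous diagonalisation in finite dimension -/

section JointEigenvectors

open scoped InnerProductSpace

variable {G E : Type*} [CommGroup G] [NormedAddCommGroup E] [InnerProductSpace ℂ E]

/-- A norm-preserving action of an abelian group on a finite-dimensional complex inner product
space is diagonalisable. -/
lemma span_joint_eigenvectors_eq_top [FiniteDimensional ℂ E] (U : G →* Module.End ℂ E)
    (hU : ∀ t v, ‖U t v‖ = ‖v‖) :
    Submodule.span ℂ {v : E | ∃ ξ : G → ℂ, ∀ t, U t v = ξ t • v} = ⊤ := by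
  have hinner (t : G) (x y : E) : ⟪U t x, y⟫_ℂ = ⟪x, U t⁻¹ y⟫_ℂ := by
    have h1 : U t (U t⁻¹ y) = y := by
      rw [← Module.End.mul_apply, ← map_mul, mul_inv_cancel, map_one, Module.End.one_apply]
    conv_lhs => rw [← h1]
    exact (LinearMap.norm_map_iff_inner_map_map (U t)).1 (hU t) x _
  -- The inverse `U t⁻¹` is the adjoint of `U t`, so these are, up to a factor 2, the real part and
  -- minus the imaginary part of `U t`. They form a commuting symmetric family, and their joint
  -- eigenvalues recover that of `U t`.
  let S (i : G × Bool) : Module.End ℂ E :=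
    bif i.2 then U i.1 + U i.1⁻¹ else Complex.I • (U i.1 - U i.1⁻¹)
  have hS (i : G × Bool) : (S i).IsSymmetric := by
    rintro x y
    obtain ⟨t, b⟩ := i
    cases b
    · simp [S, inner_smul_left, inner_smul_right, inner_sub_left, inner_sub_right, hinner]
      ring
    · simp [S, inner_add_left, inner_add_right, hinner, add_comm]
  have hUc (s t : G) : Commute (U s) (U t) := (Commute.all s t).map U
  have hc : Pairwise (Function.onFun Commute S) := by
    rintro ⟨s, b⟩ ⟨t, b'⟩ -
    have h1 := hUc s t
    have h2 := hUc s t⁻¹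
    have h3 := hUc s⁻¹ t
    have h4 := hUc s⁻¹ t⁻¹
    cases b <;> cases b' <;> simp only [S, Function.onFun, cond_true, cond_false]
    · exact ((((h1.sub_right h2).sub_left (h3.sub_right h4)).smul_left _).smul_right _)
    · exact (((h1.add_right h2).sub_left (h3.add_right h4)).smul_left _)
    · exact (((h1.sub_right h2).add_left (h3.sub_right h4)).smul_right _)
    · exact ((h1.add_right h2).add_left (h3.add_right h4))
  rw [← top_le_iff, ← LinearMap.IsSymmetric.iSup_iInf_eq_top_of_commute hS hc]
  refine iSup_le fun γ v hv => Submodule.subset_span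
    ⟨fun t => (2 : ℂ)⁻¹ * (γ (t, true) - Complex.I * γ (t, false)), fun t => ?_⟩
  rw [Submodule.mem_iInf] at hv
  have h1 := Module.End.mem_eigenspace_iff.1 (hv (t, true))
  have h2 := Module.End.mem_eigenspace_iff.1 (hv (t, false))
  simp only [S, cond_true, cond_false, LinearMap.add_apply, LinearMap.smul_apply,
    LinearMap.sub_apply] at h1 h2
  rw [mul_smul, sub_smul, mul_smul, ← h1, ← h2, smul_smul, Complex.I_mul_I, neg_one_smul,
    sub_neg_eq_add, add_add_sub_cancel, ← two_smul ℂ (U t v), smul_smul]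
  simp

end JointEigenvectors

/-! ### Continuous eigenfunctions and their characters -/

section ContinuousEigenfunctions

variable {G X : Type*} [CommGroup G] [TopologicalSpace G] [MetricSpace X] [CompactSpace X]
  [MulAction G X] [ContinuousSMul G X]

/-- A continuous invariant function is constant if there is a dense orbit. -/
lemma eq_of_invariant {E : Type*} [TopologicalSpace E] [T2Space E] {p : X}
    (hp : Dense (MulAction.orbit G p)) {f : X → E} (hf : Continuous f)
    (h : ∀ (t : G) (x : X), f (t • x) = f x) (x : X) : f x = f p := by
  have : f = fun _ => f p := hf.ext_on hp continuous_const (by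
    rintro _ ⟨t, rfl⟩
    exact h t p)
  exact congrFun this x

variable (G X) in
/-- The nonzero continuous eigenfunctions of the system. -/
def continuousEigenfunctions : Set C(X, ℂ) :=
  {g | g ≠ 0 ∧ ∃ χ : PontryaginDual G, ∀ (t : G) (x : X), g (t • x) = (χ t : ℂ) * g x}

/-- The eigenvalue of a continuous eigenfunction is a character. -/
lemma exists_character_of_eigenfunction {g : C(X, ℂ)} (hg : g ≠ 0) {ξ : G → ℂ}
    (h : ∀ (t : G) (x : X), g (t • x) = ξ t * g x) :
    ∃ χ : PontryaginDual G, ∀ t, (χ t : ℂ) = ξ t := by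
  obtain ⟨x, hx⟩ : ∃ x, g x ≠ 0 := by
    by_contra! hcon
    exact hg (ContinuousMap.ext hcon)
  have hξ (t : G) : ξ t = g (t • x) / g x := by rw [h, mul_div_cancel_right₀ _ hx]
  have hone : ξ 1 = 1 := by rw [hξ, one_smul, div_self hx]
  have hmul (s t : G) : ξ (s * t) = ξ s * ξ t := by
    rw [hξ (s * t), mul_smul, h, h, ← mul_assoc, mul_div_cancel_right₀ _ hx]
  have hcont : Continuous ξ := by
    rw [funext hξ]
    exact (continuous_orbit g x).div_const _
  have hgn : 0 < ‖g‖ := norm_pos_iff.2 hg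
  -- Translates of `g` are bounded by `‖g‖`, so no eigenvalue exceeds modulus one; applied to `t⁻¹`
  -- this forces equality.
  have hle (t : G) : ‖ξ t‖ ≤ 1 := by
    have h1 : ‖ξ t‖ * ‖g‖ ≤ ‖g‖ := by
      rw [← norm_smul]
      refine (ContinuousMap.norm_le _ hgn.le).2 fun y => ?_
      have := g.norm_coe_le_norm (t • y)
      rwa [h] at this
    nlinarith
  have hnorm (t : G) : ‖ξ t‖ = 1 := by
    have h1 : ‖ξ t‖ * ‖ξ t⁻¹‖ = 1 := by rw [← norm_mul, ← hmul, mul_inv_cancel, hone, norm_one]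
    have h2 := hle t
    have h3 := hle t⁻¹
    have h4 := norm_nonneg (ξ t)
    nlinarith
  let χ : G →ₜ* Circle :=
    { toFun := fun t => ⟨ξ t, mem_sphere_zero_iff_norm.2 (hnorm t)⟩
      map_one' := Circle.ext hone
      map_mul' := fun s t => Circle.ext (hmul s t)
      continuous_toFun := by
        apply Continuous.subtype_mk hcont }
  exact ⟨χ, fun t => rfl⟩

lemma mem_continuousEigenfunctions {g : C(X, ℂ)} (hg : g ≠ 0) {ξ : G → ℂ}
    (h : ∀ (t : G) (x : X), g (t • x) = ξ t * g x) : g ∈ continuousEigenfunctions G X := by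
  obtain ⟨χ, hχ⟩ := exists_character_of_eigenfunction hg h
  exact ⟨hg, χ, fun t x => by rw [hχ, h]⟩

end ContinuousEigenfunctions

/-! ### The unitary action on `L²` -/

section Koopman

variable {G X : Type*} [CommGroup G] [TopologicalSpace G] [MetricSpace X] [CompactSpace X]
  [MeasurableSpace X] [BorelSpace X] [MulAction G X] [ContinuousSMul G X]
  (m : Measure X) [SMulInvariantMeasure G X m]

lemma coeFn_compMeasurePreserving_smul (t : G) (f : Lp ℂ 2 m) :
    ⇑(Lp.compMeasurePreserving (t • ·) (measurePreserving_smul t m) f)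
      =ᵐ[m] fun x => f (t • x) :=
  Lp.coeFn_compMeasurePreserving f _

variable (G) in
/-- The action of `G` on `L²(X, m)` by composition. -/
noncomputable def koopman : G →* Module.End ℂ (Lp ℂ 2 m) where
  toFun t := Lp.compMeasurePreservingₗ ℂ (t • ·) (measurePreserving_smul t m)
  map_one' := LinearMap.ext fun f => Lp.ext <| by
    refine (coeFn_compMeasurePreserving_smul m (1 : G) f).trans ?_
    simp
  map_mul' s t := LinearMap.ext fun f => Lp.ext <| by
    refine (coeFn_compMeasurePreserving_smul m (s * t) f).trans ?_
    refine EventuallyEq.trans ?_ (coeFn_compMeasurePreserving_smul m s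
      (Lp.compMeasurePreserving (t • ·) (measurePreserving_smul t m) f)).symm
    have h := (measurePreserving_smul s m).quasiMeasurePreserving.ae_eq_comp
      (coeFn_compMeasurePreserving_smul m t f)
    filter_upwards [h] with x hx
    simpa [smul_smul, mul_comm s t] using hx.symm

variable {m}

lemma koopman_coeFn (t : G) (f : Lp ℂ 2 m) : ⇑(koopman G m t f) =ᵐ[m] fun x => f (t • x) :=
  coeFn_compMeasurePreserving_smul m t f

lemma norm_koopman (t : G) (f : Lp ℂ 2 m) : ‖koopman G m t f‖ = ‖f‖ :=
  Lp.norm_compMeasurePreserving f _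

variable [IsFiniteMeasure m]

lemma koopman_toLp (t : G) (g : C(X, ℂ)) :
    koopman G m t (ContinuousMap.toLp 2 m ℂ g) = ContinuousMap.toLp 2 m ℂ (actComp t g) := by
  refine Lp.ext ((koopman_coeFn t _).trans ?_)
  have h := (measurePreserving_smul t m).quasiMeasurePreserving.ae_eq_comp
    (ContinuousMap.coeFn_toLp (𝕜 := ℂ) (p := 2) m g)
  exact EventuallyEq.trans h (ContinuousMap.coeFn_toLp (𝕜 := ℂ) (p := 2) m (actComp t g)).symm

end Koopman

/-! ### Compact operators with invariant continuous kernels -/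

section KernelOperator

open scoped InnerProductSpace

variable {X : Type*} [MetricSpace X] [CompactSpace X] [MeasurableSpace X] [BorelSpace X]
  (m : Measure X) [IsFiniteMeasure m]

/-- The sections `x ↦ k(x, ·)` of a continuous kernel. -/
noncomputable def kernelCurry (k : C(X × X, ℝ)) : C(X, C(X, ℂ)) :=
  ((⟨Complex.ofReal, Complex.continuous_ofReal⟩ : C(ℝ, ℂ)).comp k).curry

/-- The sections `x ↦ k(x, ·)` of a continuous kernel as elements of `L²`. -/
noncomputable def kernelSection (k : C(X × X, ℝ)) : C(X, Lp ℂ 2 m) :=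
  ⟨fun x => ContinuousMap.toLp 2 m ℂ (kernelCurry k x),
    (ContinuousMap.toLp 2 m ℂ : C(X, ℂ) →L[ℂ] Lp ℂ 2 m).continuous.comp (kernelCurry k).continuous⟩

lemma kernelSection_coeFn (k : C(X × X, ℝ)) (x : X) :
    ⇑(kernelSection m k x) =ᵐ[m] fun y => (k (x, y) : ℂ) :=
  ContinuousMap.coeFn_toLp (𝕜 := ℂ) (p := 2) m _

/-- The operator `L² → C(X)` with a continuous kernel. -/
noncomputable def kernelMap (k : C(X × X, ℝ)) : Lp ℂ 2 m →L[ℂ] C(X, ℂ) :=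
  LinearMap.mkContinuous
    { toFun := fun f => ⟨fun x => ⟪kernelSection m k x, f⟫_ℂ, by fun_prop⟩
      map_add' := fun f f' => ContinuousMap.ext fun x => by simp [inner_add_right]
      map_smul' := fun c f => ContinuousMap.ext fun x => by simp [inner_smul_right] }
    ‖kernelSection m k‖ fun f => by
      refine (ContinuousMap.norm_le _ (by positivity)).2 fun x => ?_
      exact (norm_inner_le_norm _ _).trans
        (mul_le_mul_of_nonneg_right ((kernelSection m k).norm_coe_le_norm x) (norm_nonneg f))

lemma kernelMap_apply_eq_inner (k : C(X × X, ℝ)) (f : Lp ℂ 2 m) (x : X) :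
    kernelMap m k f x = ⟪kernelSection m k x, f⟫_ℂ := rfl

lemma kernelMap_apply (k : C(X × X, ℝ)) (f : Lp ℂ 2 m) (x : X) :
    kernelMap m k f x = ∫ y, (k (x, y) : ℂ) * f y ∂m := by
  rw [kernelMap_apply_eq_inner, L2.inner_def]
  refine integral_congr_ae ?_
  filter_upwards [kernelSection_coeFn m k x] with y hy
  rw [hy]
  simp [mul_comm]

/-- Arzelà–Ascoli: by Cauchy–Schwarz, the image of the unit ball is bounded, and it is
equicontinuous because `x ↦ k(x, ·)` is continuous into `L²`. -/
lemma isCompactOperator_kernelMap (k : C(X × X, ℝ)) : IsCompactOperator (kernelMap m k) := by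
  rw [isCompactOperator_iff_exists_mem_nhds_image_subset_compact]
  let e := ContinuousMap.isometryEquivBoundedOfCompact X ℂ
  let A : Set (BoundedContinuousFunction X ℂ) := e '' (kernelMap m k '' Metric.closedBall 0 1)
  have hA : IsCompact (closure A) := by
    refine BoundedContinuousFunction.arzela_ascoli
      (Metric.closedBall 0 ‖kernelMap m k‖) (isCompact_closedBall _ _) A ?_ ?_
    · rintro _ x ⟨_, ⟨f, hf, rfl⟩, rfl⟩
      rw [mem_closedBall_zero_iff] at hf ⊢
      calc ‖kernelMap m k f x‖ ≤ ‖kernelMap m k f‖ := ContinuousMap.norm_coe_le_norm _ x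
        _ ≤ ‖kernelMap m k‖ * 1 := (kernelMap m k).le_opNorm_of_le hf
        _ = _ := mul_one _
    · intro x
      rw [Metric.equicontinuousAt_iff]
      intro ε hε
      obtain ⟨δ, hδ, h⟩ := Metric.continuousAt_iff.1
        (kernelSection m k).continuous.continuousAt ε hε
      refine ⟨δ, hδ, fun y hy => ?_⟩
      rintro ⟨_, ⟨_, ⟨f, hf, rfl⟩, rfl⟩⟩
      rw [mem_closedBall_zero_iff] at hf
      have h1 := h hy
      rw [dist_comm] at h1
      change dist (⟪kernelSection m k x, f⟫_ℂ) (⟪kernelSection m k y, f⟫_ℂ) < ε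
      rw [dist_eq_norm, ← inner_sub_left]
      rw [dist_eq_norm] at h1
      calc _ ≤ _ := norm_inner_le_norm _ _
        _ ≤ ‖kernelSection m k x - kernelSection m k y‖ * 1 := by gcongr
        _ < ε := by rwa [mul_one]
  refine ⟨Metric.closedBall 0 1, Metric.closedBall_mem_nhds _ one_pos, e.symm '' closure A,
    hA.image e.symm.continuous, ?_⟩
  rintro _ ⟨f, hf, rfl⟩
  exact ⟨e (kernelMap m k f), subset_closure ⟨_, ⟨f, hf, rfl⟩, rfl⟩, e.symm_apply_apply _⟩

/-- The operator on `L²` with a continuous kernel. -/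
noncomputable def kernelOperator (k : C(X × X, ℝ)) : Lp ℂ 2 m →L[ℂ] Lp ℂ 2 m :=
  (ContinuousMap.toLp 2 m ℂ : C(X, ℂ) →L[ℂ] Lp ℂ 2 m).comp (kernelMap m k)

lemma kernelOperator_apply (k : C(X × X, ℝ)) (f : Lp ℂ 2 m) :
    kernelOperator m k f = ContinuousMap.toLp 2 m ℂ (kernelMap m k f) := rfl

lemma isCompactOperator_kernelOperator (k : C(X × X, ℝ)) :
    IsCompactOperator (kernelOperator m k) :=
  (isCompactOperator_kernelMap m k).clm_comp (ContinuousMap.toLp 2 m ℂ : C(X, ℂ) →L[ℂ] Lp ℂ 2 m)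

/-- Fubini for a real symmetric kernel; it applies because the kernel is bounded and `L²` functions
are integrable for a finite measure. -/
lemma isSymmetric_kernelOperator {k : C(X × X, ℝ)} (hk : ∀ x y, k (x, y) = k (y, x)) :
    (kernelOperator m k).IsSymmetric := by
  intro f g
  have hint (h : Lp ℂ 2 m) : Integrable h m := (Lp.memLp h).integrable (by norm_num)
  have hf : Integrable (fun x => (starRingEnd ℂ) (f x)) m :=
    (Complex.conjLIE : ℂ ≃ₗᵢ[ℝ] ℂ).toContinuousLinearEquiv.toContinuousLinearMap.integrable_comp
      (hint f)
  have e1 : ⟪kernelOperator m k f, g⟫_ℂ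
      = ∫ x, ∫ y, (k (x, y) : ℂ) * (g x * (starRingEnd ℂ) (f y)) ∂m ∂m := by
    rw [L2.inner_def]
    refine integral_congr_ae ?_
    filter_upwards [ContinuousMap.coeFn_toLp (𝕜 := ℂ) (p := 2) m (kernelMap m k f)] with x hx
    rw [kernelOperator_apply, hx, RCLike.inner_apply, kernelMap_apply, ← integral_conj,
      ← integral_const_mul]
    refine integral_congr_ae (Eventually.of_forall fun y => ?_)
    simp only [map_mul, Complex.conj_ofReal]
    ring
  have e2 : ⟪f, kernelOperator m k g⟫_ℂ
      = ∫ y, ∫ x, (k (x, y) : ℂ) * (g x * (starRingEnd ℂ) (f y)) ∂m ∂m := by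
    rw [L2.inner_def]
    refine integral_congr_ae ?_
    filter_upwards [ContinuousMap.coeFn_toLp (𝕜 := ℂ) (p := 2) m (kernelMap m k g)] with y hy
    rw [kernelOperator_apply, hy, RCLike.inner_apply, kernelMap_apply, ← integral_mul_const]
    refine integral_congr_ae (Eventually.of_forall fun x => ?_)
    simp only [hk y x]
    ring
  change ⟪kernelOperator m k f, g⟫_ℂ = ⟪f, kernelOperator m k g⟫_ℂ
  rw [e1, e2]
  refine integral_integral_swap ?_
  refine ((hint g).mul_prod hf).bdd_mul (c := ‖k‖) ?_ (Eventually.of_forall fun z => ?_)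
  · exact (Complex.continuous_ofReal.comp k.continuous).aestronglyMeasurable
  · change ‖((k z : ℝ) : ℂ)‖ ≤ ‖k‖
    rw [Complex.norm_real]
    exact k.norm_coe_le_norm z

variable {G : Type*} [CommGroup G] [TopologicalSpace G] [MulAction G X] [ContinuousSMul G X]
  [SMulInvariantMeasure G X m]

lemma kernelMap_koopman {k : C(X × X, ℝ)} (hk : ∀ (t : G) x y, k (t • x, t • y) = k (x, y)) (t : G)
    (f : Lp ℂ 2 m) : kernelMap m k (koopman G m t f) = actComp t (kernelMap m k f) := by
  ext x
  rw [actComp_apply, kernelMap_apply, kernelMap_apply,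
    ← integral_smul_eq_self (fun y => (k (t • x, y) : ℂ) * f y) (g := t)]
  refine integral_congr_ae ?_
  filter_upwards [koopman_coeFn t f] with y hy
  rw [hy, hk]

lemma kernelOperator_koopman {k : C(X × X, ℝ)} (hk : ∀ (t : G) x y, k (t • x, t • y) = k (x, y))
    (t : G) (f : Lp ℂ 2 m) :
    kernelOperator m k (koopman G m t f) = koopman G m t (kernelOperator m k f) := by
  rw [kernelOperator_apply, kernelOperator_apply, koopman_toLp, kernelMap_koopman m hk]

variable (G) in
/-- The closed linear span of the continuous eigenfunctions in `L²`. -/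
noncomputable def eigenfunctionSpace : Submodule ℂ (Lp ℂ 2 m) :=
  (Submodule.span ℂ (ContinuousMap.toLp 2 m ℂ '' continuousEigenfunctions G X)).topologicalClosure

/-- Compactness makes the eigenspace finite-dimensional and commutation makes it invariant, so joint
eigenvectors of `G` span it. -/
lemma eigenspace_kernelOperator_le {k : C(X × X, ℝ)}
    (hk : ∀ (t : G) x y, k (t • x, t • y) = k (x, y)) {c : ℂ} (hc : c ≠ 0) :
    Module.End.eigenspace (kernelOperator m k : Module.End ℂ (Lp ℂ 2 m)) c
      ≤ eigenfunctionSpace m G := by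
  set V := Module.End.eigenspace (kernelOperator m k : Module.End ℂ (Lp ℂ 2 m)) c
  have hV {f : Lp ℂ 2 m} : f ∈ V ↔ kernelOperator m k f = c • f := Module.End.mem_eigenspace_iff
  have : FiniteDimensional ℂ V := ContinuousLinearMap.finite_dimensional_eigenspace
    (isCompactOperator_kernelOperator m k) c hc
  have hinv (t : G) (f : Lp ℂ 2 m) (hf : f ∈ V) : koopman G m t f ∈ V := by
    rw [hV] at hf ⊢
    rw [kernelOperator_koopman m hk, hf, map_smul]
  let U : G →* Module.End ℂ V :=
    { toFun := fun t => (koopman G m t).restrict (hinv t)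
      map_one' := LinearMap.ext fun f => Subtype.ext (by simp)
      map_mul' := fun s t => LinearMap.ext fun f => Subtype.ext (by simp) }
  have hU := span_joint_eigenvectors_eq_top U fun t f => norm_koopman t (f : Lp ℂ 2 m)
  have hle : Submodule.map V.subtype ⊤ ≤ eigenfunctionSpace m G := by
    rw [← hU, Submodule.map_span_le]
    rintro ⟨f, hf⟩ ⟨ξ, hξ⟩
    rw [hV] at hf
    change f ∈ eigenfunctionSpace m G
    rcases eq_or_ne f 0 with rfl | hf0
    · exact zero_mem _
    have hξ' (t : G) : koopman G m t f = ξ t • f := congrArg Subtype.val (hξ t)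
    -- Dividing by `c ≠ 0` exhibits the eigenvector as a value of the kernel map, hence gives it a
    -- continuous representative, for which the eigenvalue equation holds at every point.
    have hfg : ContinuousMap.toLp 2 m ℂ (c⁻¹ • kernelMap m k f) = f := by
      rw [map_smul, ← kernelOperator_apply, hf, smul_smul, inv_mul_cancel₀ hc, one_smul]
    refine Submodule.le_topologicalClosure _ (Submodule.subset_span ⟨_,
      mem_continuousEigenfunctions (ξ := ξ) ?_ fun t x => ?_, hfg⟩)
    · intro h0
      rw [h0, map_zero] at hfg
      exact hf0 hfg.symm
    · have := ContinuousMap.congr_fun (kernelMap_koopman m hk t f) x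
      rw [hξ', map_smul, actComp_apply] at this
      rw [ContinuousMap.smul_apply, ContinuousMap.smul_apply, ← this, ContinuousMap.smul_apply]
      simp only [smul_eq_mul]
      ring
  simpa using hle

/-- The range of an operator with invariant symmetric continuous kernel lies in the closed span of
the continuous eigenfunctions. -/
lemma kernelOperator_mem_eigenfunctionSpace {k : C(X × X, ℝ)} (hs : ∀ x y, k (x, y) = k (y, x))
    (hk : ∀ (t : G) x y, k (t • x, t • y) = k (x, y)) (f : Lp ℂ 2 m) :
    kernelOperator m k f ∈ eigenfunctionSpace m G := by
  have hT := isSymmetric_kernelOperator m hs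
  have hcl : IsClosed (eigenfunctionSpace m G : Set (Lp ℂ 2 m)) :=
    Submodule.isClosed_topologicalClosure _
  have : CompleteSpace (eigenfunctionSpace m G) := hcl.completeSpace_coe
  rw [← Submodule.orthogonal_orthogonal (eigenfunctionSpace m G)]
  intro h hh
  -- By symmetry it is enough that the operator kills the orthogonal complement. There its values
  -- are orthogonal to every eigenspace, trivially for eigenvalue `0`, and the spectral theorem
  -- makes them vanish.
  suffices h0 : kernelOperator m k h = 0 by
    have := hT h f
    simp only [ContinuousLinearMap.coe_coe] at this
    rw [← this, h0, inner_zero_left]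
  rw [← Submodule.mem_bot ℂ, ← ContinuousLinearMap.orthogonalComplement_iSup_eigenspaces_eq_bot
    (isCompactOperator_kernelOperator m k) hT, Submodule.mem_orthogonal']
  intro v hv
  refine Submodule.iSup_induction _ (motive := fun v => ⟪kernelOperator m k h, v⟫_ℂ = 0) hv
    (fun c v hv => ?_) (inner_zero_right _) fun v w hv hw => by rw [inner_add_right, hv, hw, add_zero]
  have h1 := hT h v
  simp only [ContinuousLinearMap.coe_coe] at h1
  have h2 : kernelOperator m k v = c • v := Module.End.mem_eigenspace_iff.1 hv
  rw [h1, h2, inner_smul_right]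
  rcases eq_or_ne c 0 with rfl | hc
  · exact zero_mul _
  · rw [(Submodule.mem_orthogonal' _ _).1 hh v (eigenspace_kernelOperator_le m hk hc hv), mul_zero]

end KernelOperator

/-! ### The kernel `max (δ - D) 0` as an approximate identity -/

section MeanKernel

variable {G X : Type*} [CommGroup G] [TopologicalSpace G] [IsTopologicalGroup G]
  [MeasurableSpace G] [BorelSpace G] {μ : Measure G} [μ.IsHaarMeasure] {B : ℕ → Set G}
  [MetricSpace X] [CompactSpace X] [MulAction G X] [ContinuousSMul G X]

instance smulInvariantMeasure_prod [MeasurableSpace X] [BorelSpace X] (m : Measure X)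
    [SFinite m] [SMulInvariantMeasure G X m] : SMulInvariantMeasure G (X × X) (m.prod m) :=
  ⟨fun t _ hs => ((measurePreserving_smul t m).prod
    (measurePreserving_smul t m)).measure_preimage hs.nullMeasurableSet⟩

variable (μ B) in
/-- The kernel `max (δ - D) 0` for the Besicovitch pseudometric `D`. -/
noncomputable def meanKernel (hc : Continuous fun z : X × X => meanDist μ B z.1 z.2) (δ : ℝ) :
    C(X × X, ℝ) :=
  ⟨fun z => max (δ - meanDist μ B z.1 z.2) 0, (continuous_const.sub hc).max continuous_const⟩

variable {hc : Continuous fun z : X × X => meanDist μ B z.1 z.2} {δ : ℝ}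

lemma meanKernel_apply (x y : X) :
    meanKernel μ B hc δ (x, y) = max (δ - meanDist μ B x y) 0 := rfl

lemma meanKernel_nonneg (z : X × X) : 0 ≤ meanKernel μ B hc δ z := le_max_right _ _

lemma meanKernel_comm (hB : IsFolnerSequence μ B) (x y : X) :
    meanKernel μ B hc δ (x, y) = meanKernel μ B hc δ (y, x) := by
  rw [meanKernel_apply, meanKernel_apply, meanDist_comm hB]

lemma meanKernel_smul (hB : IsFolnerSequence μ B) (t : G) (x y : X) :
    meanKernel μ B hc δ (t • x, t • y) = meanKernel μ B hc δ (x, y) := by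
  rw [meanKernel_apply, meanKernel_apply, meanDist_smul hB]

variable [MeasurableSpace X] [BorelSpace X] (m : Measure X) [IsProbabilityMeasure m]
  [SMulInvariantMeasure G X m]

/-- The kernel only controls asymptotic distances, not `dist` itself. Since it is invariant, `dist`
may be replaced under the integral by its orbit averages, and these are eventually below `δ`
wherever the kernel is nonzero. -/
lemma integral_meanKernel_mul_dist_le (hB : IsFolnerSequence μ B) (hδ : 0 < δ) :
    ∫ z, meanKernel μ B hc δ z * distMap X z ∂(m.prod m)
      ≤ δ * ∫ z, meanKernel μ B hc δ z ∂(m.prod m) := by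
  set k := meanKernel μ B hc δ
  have hint (F : C(X × X, ℝ)) : Integrable F (m.prod m) := F.integrable_of_compactSpace _
  have havg (n : ℕ) (z : X × X) : orbitAverage μ B n (k * distMap X) z
      = k z * orbitAverage μ B n (distMap X) z := by
    rw [orbitAverage_apply hB, orbitAverage_apply hB, ← integral_const_mul]
    exact integral_congr_ae (Eventually.of_forall fun u =>
      congrArg (· * _) (meanKernel_smul hB u z.1 z.2))
  -- Taking the maximum with `δ` makes the integrand eventually constant at each point, so dominated
  -- convergence applies although the averages of the distance need not converge.
  have hle (n : ℕ) : ∫ z, k z * distMap X z ∂(m.prod m)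
      ≤ ∫ z, k z * max (orbitAverage μ B n (distMap X) z) δ ∂(m.prod m) := by
    calc _ = ∫ z, orbitAverage μ B n (k * distMap X) z ∂(m.prod m) :=
          (integral_orbitAverage hB (m.prod m) n (k * distMap X)).symm
      _ ≤ _ := by
        refine integral_mono (hint _)
          (hint (k * ((orbitAverage μ B n (distMap X)) ⊔ ContinuousMap.const _ δ))) fun z => ?_
        rw [havg]
        exact mul_le_mul_of_nonneg_left (le_max_left _ _) (meanKernel_nonneg z)
  have hlim : Tendsto (fun n => ∫ z, k z * max (orbitAverage μ B n (distMap X) z) δ ∂(m.prod m))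
      atTop (𝓝 (∫ z, k z * δ ∂(m.prod m))) := by
    refine tendsto_integral_of_dominated_convergence (fun _ => ‖k‖ * (‖distMap X‖ + δ))
      (fun n => ?_) (integrable_const _) (fun n => Eventually.of_forall fun z => ?_)
      (Eventually.of_forall fun z => ?_)
    · exact (hint (k * ((orbitAverage μ B n (distMap X)) ⊔
        ContinuousMap.const _ δ))).aestronglyMeasurable
    · rw [norm_mul]
      have h1 := (orbitAverage μ B n (distMap X)).norm_coe_le_norm z
      have h2 := norm_orbitAverage_le hB n (distMap X)
      have h3 := norm_nonneg (distMap X)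
      gcongr
      · exact k.norm_coe_le_norm z
      · rw [Real.norm_eq_abs, abs_of_nonneg (hδ.le.trans (le_max_right _ _))]
        refine max_le ?_ (by linarith)
        exact (le_abs_self _).trans (by rw [← Real.norm_eq_abs]; linarith)
    · obtain ⟨x, y⟩ := z
      by_cases hz : meanDist μ B x y < δ
      · obtain ⟨c, hcδ, hev⟩ := (meanDist_lt_iff hB).1 hz
        refine tendsto_const_nhds.congr' ?_
        filter_upwards [hev] with n hn
        rw [max_eq_right (hn.trans hcδ.le)]
      · have : k (x, y) = 0 := max_eq_right (by linarith)
        simp [this]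
  rw [integral_mul_const, mul_comm] at hlim
  exact ge_of_tendsto' hlim hle

lemma kernelMap_toLp (k : C(X × X, ℝ)) (f : C(X, ℂ)) (x : X) :
    kernelMap m k (ContinuousMap.toLp 2 m ℂ f) x = ∫ y, (k (x, y) : ℂ) * f y ∂m := by
  rw [kernelMap_apply]
  refine integral_congr_ae ?_
  filter_upwards [ContinuousMap.coeFn_toLp (𝕜 := ℂ) (p := 2) m f] with y hy
  rw [hy]

/-- The mass of the section at `x` is continuous and invariant in `x`, so the dense orbit makes it
constant. -/
lemma integral_meanKernel_eq (hB : IsFolnerSequence μ B) {p : X}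
    (hp : Dense (MulAction.orbit G p)) (x : X) :
    ∫ y, meanKernel μ B hc δ (x, y) ∂m = ∫ y, meanKernel μ B hc δ (p, y) ∂m := by
  refine eq_of_invariant (f := fun x => ∫ y, meanKernel μ B hc δ (x, y) ∂m) hp ?_ (fun t x => ?_) x
  · have h : ∀ x, kernelMap m (meanKernel μ B hc δ) (ContinuousMap.toLp 2 m ℂ 1) x
        = ((∫ y, meanKernel μ B hc δ (x, y) ∂m : ℝ) : ℂ) := by
      intro x
      rw [kernelMap_toLp]
      simp [integral_complex_ofReal]
    have := Complex.continuous_re.comp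
      (kernelMap m (meanKernel μ B hc δ) (ContinuousMap.toLp 2 m ℂ 1)).continuous
    refine this.congr fun x => ?_
    rw [Function.comp_apply, h, Complex.ofReal_re]
  · rw [← integral_smul_eq_self (fun y => meanKernel μ B hc δ (t • x, y)) (g := t)]
    simp_rw [meanKernel_smul hB]

/-- If the mass were zero, it would be zero at every `x`; the kernel is positive near the diagonal,
so every point would have a null neighbourhood, and compactness would give `m` total mass zero. -/
lemma integral_meanKernel_pos (hB : IsFolnerSequence μ B) {p : X}
    (hp : Dense (MulAction.orbit G p)) (hδ : 0 < δ) :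
    0 < ∫ y, meanKernel μ B hc δ (p, y) ∂m := by
  refine lt_of_le_of_ne (integral_nonneg fun y => meanKernel_nonneg _) fun h0 => ?_
  have hloc : ∀ x ∈ (Set.univ : Set X), ∃ s ∈ 𝓝[Set.univ] x, m s = 0 := by
    intro x _
    have hx : ∫ y, meanKernel μ B hc δ (x, y) ∂m = 0 := by
      rw [integral_meanKernel_eq m hB hp, ← h0]
    have hcont : Continuous fun y => meanKernel μ B hc δ (x, y) := by fun_prop
    rw [integral_eq_zero_iff_of_nonneg (fun y => meanKernel_nonneg _)
      (hcont.integrable_of_hasCompactSupport (HasCompactSupport.of_compactSpace _))] at hx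
    refine ⟨{y | meanKernel μ B hc δ (x, y) ≠ 0}, ?_, hx⟩
    rw [nhdsWithin_univ]
    refine (isOpen_ne_fun hcont continuous_const).mem_nhds ?_
    have hxx : meanDist μ B x x ≤ 0 := by
      refine le_of_forall_gt fun c hc' => (meanDist_lt_iff hB).2
        ⟨0, hc', Eventually.of_forall fun n => ?_⟩
      rw [orbitAverage_apply hB]
      exact integral_nonpos fun u => (dist_self (u • x)).le
    change max (δ - meanDist μ B x x) 0 ≠ 0
    rw [max_eq_left (by linarith)]
    linarith
  have := isCompact_univ.measure_zero_of_nhdsWithin hloc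
  rw [measure_univ] at this
  exact one_ne_zero this

lemma norm_toLp_sq (h : C(X, ℂ)) :
    ‖(ContinuousMap.toLp 2 m ℂ h : Lp ℂ 2 m)‖ ^ 2 = ∫ x, ‖h x‖ ^ 2 ∂m := by
  have h1 := ContinuousMap.inner_toLp (𝕜 := ℂ) m h h
  rw [inner_self_eq_norm_sq_to_K] at h1
  have h2 : ∀ x, h x * (starRingEnd ℂ) (h x) = ((‖h x‖ ^ 2 : ℝ) : ℂ) := fun x => by
    rw [Complex.mul_conj, Complex.normSq_eq_norm_sq]
  simp_rw [h2] at h1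
  rw [integral_complex_ofReal] at h1
  exact Complex.ofReal_injective ((Complex.ofReal_pow _ _).trans h1)

/-- Up to normalisation, the operators with kernel `max (δ - D) 0` approximate the identity. -/
lemma norm_toLp_sub_kernelOperator_sq_le (hB : IsFolnerSequence μ B) {p : X}
    (hp : Dense (MulAction.orbit G p)) (f : C(X, ℂ)) {ε C : ℝ} (hC : 0 < C)
    (hf : ∀ x y, dist (f x) (f y) ≤ ε + C * dist x y) (hδ : 0 < δ) :
    ‖ContinuousMap.toLp 2 m ℂ f - ((∫ y, meanKernel μ B hc δ (p, y) ∂m : ℝ) : ℂ)⁻¹ •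
      kernelOperator m (meanKernel μ B hc δ) (ContinuousMap.toLp 2 m ℂ f)‖ ^ 2
      ≤ 2 * ‖f‖ * (ε + C * δ) := by
  set k := meanKernel μ B hc δ
  set c := ∫ y, k (p, y) ∂m
  have hcpos : 0 < c := integral_meanKernel_pos m hB hp hδ
  have hcx (x : X) : ∫ y, k (x, y) ∂m = c := integral_meanKernel_eq m hB hp x
  set h : C(X, ℂ) := f - (c : ℂ)⁻¹ • kernelMap m k (ContinuousMap.toLp 2 m ℂ f) with hh
  have hint (F : C(X × X, ℝ)) : Integrable F (m.prod m) := F.integrable_of_compactSpace _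
  have hint' {F : X → ℝ} (hF : Continuous F) : Integrable F m :=
    hF.integrable_of_hasCompactSupport (HasCompactSupport.of_compactSpace _)
  have hint'' {F : X → ℂ} (hF : Continuous F) : Integrable F m :=
    hF.integrable_of_hasCompactSupport (HasCompactSupport.of_compactSpace _)
  have hkx (x : X) : Continuous fun y => k (x, y) := by fun_prop
  -- Because the mass `c` is the same at every point, `h x` is the kernel-weighted mean of `f x - f
  -- y`.
  have hhx (x : X) : h x = (c : ℂ)⁻¹ * ∫ y, (k (x, y) : ℂ) * (f x - f y) ∂m := by
    have h1 : ∫ y, (k (x, y) : ℂ) * (f x - f y) ∂m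
        = c * f x - ∫ y, (k (x, y) : ℂ) * f y ∂m := by
      simp_rw [mul_sub]
      rw [integral_sub (hint'' (by fun_prop)) (hint'' (by fun_prop)), integral_mul_const,
        integral_complex_ofReal, hcx]
    rw [h1, mul_sub, ← mul_assoc, inv_mul_cancel₀ (by exact_mod_cast hcpos.ne'), one_mul,
      ← kernelMap_toLp]
    rfl
  have hbound (x : X) : ‖h x‖ ≤ c⁻¹ * ∫ y, k (x, y) * dist (f x) (f y) ∂m := by
    rw [hhx, norm_mul, norm_inv, Complex.norm_real, Real.norm_of_nonneg hcpos.le]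
    gcongr
    refine (norm_integral_le_integral_norm _).trans_eq ?_
    refine integral_congr_ae (Eventually.of_forall fun y => ?_)
    simp only [norm_mul, Complex.norm_real, dist_eq_norm]
    rw [Real.norm_of_nonneg (meanKernel_nonneg _)]
  have hb1 (x : X) : ‖h x‖ ≤ 2 * ‖f‖ := by
    refine (hbound x).trans ?_
    have : ∫ y, k (x, y) * dist (f x) (f y) ∂m ≤ ∫ y, k (x, y) * (2 * ‖f‖) ∂m := by
      refine integral_mono (hint' (by fun_prop)) (hint' (by fun_prop)) fun y => ?_
      refine mul_le_mul_of_nonneg_left ?_ (meanKernel_nonneg _)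
      have := dist_le_norm_add_norm (f x) (f y)
      have := f.norm_coe_le_norm x
      have := f.norm_coe_le_norm y
      linarith
    rw [integral_mul_const, hcx] at this
    calc _ ≤ c⁻¹ * (c * (2 * ‖f‖)) := by gcongr
      _ = _ := by field_simp
  have hb2 (x : X) : ‖h x‖ ≤ ε + C * c⁻¹ * ∫ y, k (x, y) * dist x y ∂m := by
    refine (hbound x).trans ?_
    have : ∫ y, k (x, y) * dist (f x) (f y) ∂m
        ≤ ∫ y, (k (x, y) * ε + C * (k (x, y) * dist x y)) ∂m := by
      refine integral_mono (hint' (by fun_prop)) (hint' (by fun_prop)) fun y => ?_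
      have := mul_le_mul_of_nonneg_left (hf x y) (meanKernel_nonneg (hc := hc) (δ := δ) (x, y))
      simp only
      linarith
    rw [integral_add (hint' (by fun_prop)) (hint' (by fun_prop)), integral_mul_const,
      integral_const_mul, hcx] at this
    calc _ ≤ c⁻¹ * (c * ε + C * ∫ y, k (x, y) * dist x y ∂m) := by gcongr
      _ = _ := by field_simp
  have hprod : ∫ x, ∫ y, k (x, y) * dist x y ∂m ∂m ≤ δ * c := by
    have h1 : ∫ z, (k * distMap X) z ∂(m.prod m) ≤ δ * ∫ z, k z ∂(m.prod m) :=
      integral_meanKernel_mul_dist_le m hB hδ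
    rw [integral_prod _ (hint (k * distMap X)), integral_prod _ (hint k)] at h1
    have h2 : ∫ x, ∫ y, k (x, y) ∂m ∂m = c := by
      simp_rw [hcx]
      simp
    exact h1.trans_eq (by rw [h2])
  have hinth : Integrable (fun x => ∫ y, k (x, y) * dist x y ∂m) m :=
    (hint (k * distMap X)).integral_prod_left
  have hb3 : ∫ x, ‖h x‖ ∂m ≤ ε + C * δ := by
    calc _ ≤ ∫ x, (ε + C * c⁻¹ * ∫ y, k (x, y) * dist x y ∂m) ∂m :=
          integral_mono (hint' (by fun_prop)) ((integrable_const ε).add (hinth.const_mul _)) hb2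
      _ = ε + C * c⁻¹ * ∫ x, ∫ y, k (x, y) * dist x y ∂m ∂m := by
          rw [integral_add (integrable_const ε) (hinth.const_mul _), integral_const_mul]
          simp
      _ ≤ ε + C * c⁻¹ * (δ * c) := by gcongr
      _ = _ := by field_simp
  have hLp : ContinuousMap.toLp 2 m ℂ f - (c : ℂ)⁻¹ •
      kernelOperator m k (ContinuousMap.toLp 2 m ℂ f) = ContinuousMap.toLp 2 m ℂ h := by
    rw [hh, map_sub, map_smul, kernelOperator_apply]
  rw [hLp, norm_toLp_sq]
  -- The integral estimate on distances yields only an `L¹` bound for `h`; the uniform bound `2 *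
  -- ‖f‖` upgrades it to `L²`.
  calc ∫ x, ‖h x‖ ^ 2 ∂m ≤ ∫ x, 2 * ‖f‖ * ‖h x‖ ∂m := by
        refine integral_mono (hint' (by fun_prop)) (hint' (by fun_prop)) fun x => ?_
        have := mul_le_mul_of_nonneg_right (hb1 x) (norm_nonneg (h x))
        simpa [sq] using this
    _ = 2 * ‖f‖ * ∫ x, ‖h x‖ ∂m := integral_const_mul _ _
    _ ≤ _ := by gcongr

/-- Continuous eigenfunctions span a dense subspace if there is a transitive Weyl almost periodic
point. -/
lemma WeylAlmostPeriodicPoint.eigenfunctionSpace_eq_top (hB : IsFolnerSequence μ B) {p : X}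
    (hp : Dense (MulAction.orbit G p)) (hw : WeylAlmostPeriodicPoint μ B p) :
    eigenfunctionSpace m G = ⊤ := by
  have hc := hw.continuous_meanDist hB hp
  have hcl : IsClosed (eigenfunctionSpace m G : Set (Lp ℂ 2 m)) :=
    Submodule.isClosed_topologicalClosure _
  have hdense : DenseRange (ContinuousMap.toLp 2 m ℂ : C(X, ℂ) →L[ℂ] Lp ℂ 2 m) :=
    ContinuousMap.toLp_denseRange ℂ m ℂ (by norm_num)
  rw [← top_le_iff]
  intro F _
  refine hcl.closure_subset_iff.2 ?_ (hdense F)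
  rintro _ ⟨f, rfl⟩
  rw [← hcl.closure_eq, Metric.mem_closure_iff]
  intro η hη
  obtain ⟨ε, hε, hεη⟩ : ∃ ε > 0, 2 * ‖f‖ * (ε + ε) < η ^ 2 := by
    refine ⟨η ^ 2 / (4 * (‖f‖ + 1)), by positivity, ?_⟩
    have h1 : 2 * ‖f‖ * (η ^ 2 / (4 * (‖f‖ + 1)) + η ^ 2 / (4 * (‖f‖ + 1)))
        = η ^ 2 * (‖f‖ / (‖f‖ + 1)) := by field_simp; ring
    rw [h1]
    have h2 : ‖f‖ / (‖f‖ + 1) < 1 := (div_lt_one (by positivity)).2 (lt_add_one _)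
    exact mul_lt_of_lt_one_right (by positivity) h2
  obtain ⟨C, hC, hf⟩ := exists_dist_le_add_mul_dist f hε
  -- With `δ = ε / C` the error `ε + C * δ` becomes `ε + ε`, as prepared in the choice of `ε`.
  have hδ : 0 < ε / C := by positivity
  have key := norm_toLp_sub_kernelOperator_sq_le m (hc := hc) hB hp f hC hf hδ
  rw [mul_div_cancel₀ _ hC.ne'] at key
  have hmem := Submodule.smul_mem _
    ((∫ y, meanKernel μ B hc (ε / C) (p, y) ∂m : ℝ) : ℂ)⁻¹ (kernelOperator_mem_eigenfunctionSpace m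
    (meanKernel_comm (hc := hc) (δ := ε / C) hB) (meanKernel_smul hB) (ContinuousMap.toLp 2 m ℂ f))
  refine ⟨_, hmem, ?_⟩
  rw [dist_eq_norm]
  exact lt_of_pow_lt_pow_left₀ 2 hη.le (key.trans_lt hεη)

end MeanKernel

/-! ### Totality of continuous eigenfunctions and the spectral conditions -/

section Spectrum

open scoped InnerProductSpace

variable {G X : Type*} [CommGroup G] [TopologicalSpace G] [MetricSpace X] [CompactSpace X]
  [MulAction G X] [ContinuousSMul G X]

/-- Continuous eigenfunctions have constant modulus if there is a dense orbit. -/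
lemma norm_eigenfunction_eq {p : X} (hp : Dense (MulAction.orbit G p)) {g : C(X, ℂ)}
    {χ : PontryaginDual G} (h : ∀ (t : G) (x : X), g (t • x) = (χ t : ℂ) * g x) (x : X) :
    ‖g x‖ = ‖g p‖ :=
  eq_of_invariant (f := fun x => ‖g x‖) hp (by fun_prop)
    (fun t x => by rw [h, norm_mul, Circle.norm_coe, one_mul]) x

lemma eigenfunction_apply_ne_zero {p : X} (hp : Dense (MulAction.orbit G p)) {g : C(X, ℂ)}
    (hg : g ≠ 0) {χ : PontryaginDual G} (h : ∀ (t : G) (x : X), g (t • x) = (χ t : ℂ) * g x)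
    (x : X) : g x ≠ 0 := by
  intro h0
  refine hg (ContinuousMap.ext fun y => norm_eq_zero.1 ?_)
  rw [norm_eigenfunction_eq hp h y, ← norm_eigenfunction_eq hp h x, h0, norm_zero]

lemma exists_unimodular_eigenfunction {p : X} (hp : Dense (MulAction.orbit G p)) {g : C(X, ℂ)}
    (hg : g ≠ 0) {χ : PontryaginDual G} (h : ∀ (t : G) (x : X), g (t • x) = (χ t : ℂ) * g x) :
    ∃ e : C(X, ℂ), (∀ x, ‖e x‖ = 1) ∧ ∀ (t : G) (x : X), e (t • x) = (χ t : ℂ) * e x := by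
  have hgp := eigenfunction_apply_ne_zero hp hg h p
  refine ⟨(g p)⁻¹ • g, fun x => ?_, fun t x => ?_⟩
  · rw [ContinuousMap.smul_apply, norm_smul, norm_inv, norm_eigenfunction_eq hp h x,
      inv_mul_cancel₀ (norm_ne_zero_iff.2 hgp)]
  · simp only [ContinuousMap.smul_apply, smul_eq_mul, h]
    ring

/-- Continuous eigenfunctions with the same eigenvalue are proportional if there is a dense
orbit. -/
lemma eigenfunction_eq_smul {p : X} (hp : Dense (MulAction.orbit G p)) {g e : C(X, ℂ)}
    {χ : PontryaginDual G} (he : ∀ x, ‖e x‖ = 1)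
    (heχ : ∀ (t : G) (x : X), e (t • x) = (χ t : ℂ) * e x)
    (h : ∀ (t : G) (x : X), g (t • x) = (χ t : ℂ) * g x) : ∃ c : ℂ, g = c • e := by
  have he0 (x : X) : e x ≠ 0 := norm_ne_zero_iff.1 (by rw [he]; exact one_ne_zero)
  refine ⟨g p / e p, ContinuousMap.ext fun x => ?_⟩
  have := eq_of_invariant (f := fun x => g x / e x) hp (g.continuous.div e.continuous he0)
    (fun t x => by rw [h, heχ, mul_div_mul_left _ _ (Circle.coe_ne_zero _)]) x
  rw [ContinuousMap.smul_apply, smul_eq_mul, ← this, div_mul_cancel₀ _ (he0 x)]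

variable [MeasurableSpace X] [BorelSpace X] {m : Measure X} [SMulInvariantMeasure G X m]

lemma isEigenfunctionFor_iff {ξ : G → ℂ} {f : Lp ℂ 2 m} :
    IsEigenfunctionFor m ξ f ↔ f ≠ 0 ∧ ∀ t, koopman G m t f = ξ t • f := by
  refine and_congr_right fun _ => forall_congr' fun t => ?_
  rw [Lp.ext_iff]
  refine ⟨fun h => ?_, fun h => ?_⟩
  · exact ((koopman_coeFn t f).trans h).trans (Lp.coeFn_smul (ξ t) f).symm
  · exact ((koopman_coeFn t f).symm.trans h).trans (Lp.coeFn_smul (ξ t) f)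

lemma IsEigenfunctionFor.norm_eq_one {ξ : G → ℂ} {f : Lp ℂ 2 m} (h : IsEigenfunctionFor m ξ f)
    (t : G) : ‖ξ t‖ = 1 := by
  obtain ⟨h0, h⟩ := isEigenfunctionFor_iff.1 h
  have := norm_koopman t f
  rw [h, norm_smul] at this
  exact mul_right_cancel₀ (norm_ne_zero_iff.2 h0) (this.trans (one_mul _).symm)

/-- Eigenfunctions for different eigenvalues are orthogonal. -/
lemma inner_eigenfunctions_eq_zero {ξ ξ' : G → ℂ} {f f' : Lp ℂ 2 m}
    (h : IsEigenfunctionFor m ξ f) (h' : IsEigenfunctionFor m ξ' f') (hne : ξ ≠ ξ') :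
    ⟪f, f'⟫_ℂ = 0 := by
  by_contra h0
  refine hne (funext fun t => ?_)
  have h1 : ⟪koopman G m t f, koopman G m t f'⟫_ℂ = ⟪f, f'⟫_ℂ :=
    (LinearMap.norm_map_iff_inner_map_map (koopman G m t)).1 (norm_koopman t) f f'
  rw [(isEigenfunctionFor_iff.1 h).2, (isEigenfunctionFor_iff.1 h').2, inner_smul_left,
    inner_smul_right, ← mul_assoc] at h1
  have h2 : (starRingEnd ℂ) (ξ t) * ξ' t = 1 :=
    mul_right_cancel₀ h0 (h1.trans (one_mul _).symm)
  have h3 : ξ t * (starRingEnd ℂ) (ξ t) = 1 := by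
    rw [Complex.mul_conj, Complex.normSq_eq_norm_sq, h.norm_eq_one]
    norm_num
  calc ξ t = ξ t * ((starRingEnd ℂ) (ξ t) * ξ' t) := by rw [h2, mul_one]
    _ = ξ' t := by rw [← mul_assoc, h3, one_mul]

lemma isEigenfunctionFor_toLp [IsProbabilityMeasure m] {e : C(X, ℂ)} (he : ∀ x, ‖e x‖ = 1)
    {χ : PontryaginDual G} (heχ : ∀ (t : G) (x : X), e (t • x) = (χ t : ℂ) * e x) :
    IsEigenfunctionFor m (fun t : G => (χ t : ℂ)) (ContinuousMap.toLp 2 m ℂ e) ∧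
      ‖(ContinuousMap.toLp 2 m ℂ e : Lp ℂ 2 m)‖ = 1 := by
  have hn : ‖(ContinuousMap.toLp 2 m ℂ e : Lp ℂ 2 m)‖ = 1 := by
    have := norm_toLp_sq m e
    simp_rw [he] at this
    rw [← pow_left_inj₀ (norm_nonneg _) zero_le_one two_ne_zero]
    simpa using this
  refine ⟨isEigenfunctionFor_iff.2 ⟨norm_ne_zero_iff.1 (by rw [hn]; exact one_ne_zero),
    fun t => ?_⟩, hn⟩
  rw [koopman_toLp, ← map_smul]
  congr 1
  exact ContinuousMap.ext fun x => heχ t x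

/-- If the continuous eigenfunctions are total, the system has pure point spectrum. -/
lemma hasPurePointSpectrum_of_eigenfunctionSpace [IsProbabilityMeasure m] {p : X}
    (hp : Dense (MulAction.orbit G p)) (h : eigenfunctionSpace m G = ⊤) :
    HasPurePointSpectrum G m := by
  -- One unimodular function per eigenvalue suffices, since continuous eigenfunctions with a common
  -- eigenvalue are proportional.
  let Ξ : Set (PontryaginDual G) :=
    {χ | ∃ g : C(X, ℂ), g ≠ 0 ∧ ∀ (t : G) (x : X), g (t • x) = (χ t : ℂ) * g x}
  have hex (χ : Ξ) : ∃ e : C(X, ℂ), (∀ x, ‖e x‖ = 1) ∧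
      ∀ (t : G) (x : X), e (t • x) = ((χ : PontryaginDual G) t : ℂ) * e x := by
    obtain ⟨χ, g, hg, hgχ⟩ := χ
    exact exists_unimodular_eigenfunction hp hg hgχ
  choose e he heχ using hex
  let v (χ : Ξ) : Lp ℂ 2 m := ContinuousMap.toLp 2 m ℂ (e χ)
  have hv (χ : Ξ) := isEigenfunctionFor_toLp (m := m) (he χ) (heχ χ)
  have horth : Orthonormal ℂ v := by
    refine ⟨fun χ => (hv χ).2, fun χ χ' hne => ?_⟩
    refine inner_eigenfunctions_eq_zero (hv χ).1 (hv χ').1 fun heq => hne (Subtype.ext ?_)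
    exact DFunLike.ext _ _ fun t => Circle.ext (congrFun heq t)
  have hspan : (⊤ : Submodule ℂ (Lp ℂ 2 m)) ≤ (Submodule.span ℂ
      (Set.range ((↑) : Set.range v → Lp ℂ 2 m))).topologicalClosure := by
    rw [← h, Subtype.range_coe]
    refine Submodule.topologicalClosure_mono (Submodule.span_le.2 ?_)
    rintro _ ⟨g, ⟨hg, χ, hgχ⟩, rfl⟩
    obtain ⟨c, hc⟩ := eigenfunction_eq_smul hp (he ⟨χ, g, hg, hgχ⟩) (heχ ⟨χ, g, hg, hgχ⟩) hgχ
    rw [hc, map_smul]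
    exact Submodule.smul_mem _ _ (Submodule.subset_span ⟨_, rfl⟩)
  refine ⟨Set.range v, HilbertBasis.mk horth.toSubtypeRange hspan, HilbertBasis.coe_mk _ _, ?_⟩
  rintro _ ⟨χ, rfl⟩
  exact ⟨_, (hv χ).1⟩

/-- A nonzero function is not orthogonal to all continuous eigenfunctions if these are total. -/
lemma exists_inner_ne_zero [IsProbabilityMeasure m] {p : X} (hp : Dense (MulAction.orbit G p))
    (h : eigenfunctionSpace m G = ⊤) {f : Lp ℂ 2 m} (hf : f ≠ 0) :
    ∃ (χ : PontryaginDual G) (e : C(X, ℂ)), (∀ x, ‖e x‖ = 1) ∧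
      (∀ (t : G) (x : X), e (t • x) = (χ t : ℂ) * e x) ∧
        ⟪ContinuousMap.toLp 2 m ℂ e, f⟫_ℂ ≠ 0 := by
  by_contra! hcon
  have hmem : f ∈ (Submodule.span ℂ
      (ContinuousMap.toLp 2 m ℂ '' continuousEigenfunctions G X))ᗮ := by
    rw [Submodule.mem_orthogonal]
    intro u hu
    induction hu using Submodule.span_induction with
    | mem u hu =>
      obtain ⟨g, ⟨hg, χ, hgχ⟩, rfl⟩ := hu
      obtain ⟨e, he, heχ⟩ := exists_unimodular_eigenfunction hp hg hgχ
      obtain ⟨c, rfl⟩ := eigenfunction_eq_smul hp he heχ hgχ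
      rw [map_smul, inner_smul_left, hcon χ e he heχ, mul_zero]
    | zero => exact inner_zero_left _
    | add u w _ _ hu hw => rw [inner_add_left, hu, hw, add_zero]
    | smul c u _ hu => rw [inner_smul_left, hu, mul_zero]
  rw [← Submodule.orthogonal_closure, ← eigenfunctionSpace, h, Submodule.top_orthogonal_eq_bot]
    at hmem
  exact hf hmem

/-- If the continuous eigenfunctions are total, all eigenfunctions are continuous. -/
lemma hasContinuousEigenfunctions_of_eigenfunctionSpace [IsProbabilityMeasure m] {p : X}
    (hp : Dense (MulAction.orbit G p)) (h : eigenfunctionSpace m G = ⊤) :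
    HasContinuousEigenfunctions G m := by
  -- By totality an eigenfunction correlates with some continuous one, and orthogonality then forces
  -- the eigenvalues to agree.
  have key {ξ : G → ℂ} {f : Lp ℂ 2 m} (hf : IsEigenfunctionFor m ξ f) :
      ∃ (χ : PontryaginDual G) (e : C(X, ℂ)), (∀ x, ‖e x‖ = 1) ∧
      (∀ (t : G) (x : X), e (t • x) = (χ t : ℂ) * e x) ∧ (fun t => (χ t : ℂ)) = ξ ∧
        ⟪ContinuousMap.toLp 2 m ℂ e, f⟫_ℂ ≠ 0 := by
    obtain ⟨χ, e, he, heχ, hne⟩ := exists_inner_ne_zero hp h hf.1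
    refine ⟨χ, e, he, heχ, ?_, hne⟩
    by_contra hξ
    exact hne (inner_eigenfunctions_eq_zero (isEigenfunctionFor_toLp he heχ).1 hf hξ)
  intro ξ f hf
  obtain ⟨χ, e, he, heχ, rfl, -⟩ := key hf
  obtain ⟨hve, hvn⟩ := isEigenfunctionFor_toLp (m := m) he heχ
  set v : Lp ℂ 2 m := ContinuousMap.toLp 2 m ℂ e with hv
  obtain ⟨c, hc⟩ : ∃ c : ℂ, f = c • v := by
    refine ⟨⟪v, f⟫_ℂ, ?_⟩
    -- Otherwise the part of `f` orthogonal to `v` would be an eigenfunction with the same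
    -- eigenvalue, hence would correlate with a multiple of `e`.
    by_contra hne
    have hr : IsEigenfunctionFor m (fun t : G => (χ t : ℂ)) (f - ⟪v, f⟫_ℂ • v) := by
      refine isEigenfunctionFor_iff.2 ⟨sub_ne_zero.2 hne, fun t => ?_⟩
      rw [map_sub, map_smul, (isEigenfunctionFor_iff.1 hf).2, (isEigenfunctionFor_iff.1 hve).2,
        smul_sub, smul_comm]
    obtain ⟨χ', e', he', heχ', hχ, hne'⟩ := key hr
    have hχ' : χ' = χ := DFunLike.ext _ _ fun t => Circle.ext (congrFun hχ t)
    subst hχ'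
    obtain ⟨c, rfl⟩ := eigenfunction_eq_smul hp he heχ heχ'
    refine hne' ?_
    rw [map_smul, inner_smul_left, inner_sub_right, inner_smul_right, ← hv,
      inner_self_eq_norm_sq_to_K, hvn]
    simp
  refine ⟨c • e, ?_, fun t x => ?_⟩
  · rw [hc, hv, ← map_smul]
    exact ContinuousMap.coeFn_toLp (𝕜 := ℂ) (p := 2) m _
  · simp only [ContinuousMap.smul_apply, smul_eq_mul, heχ]
    ring

/-- Pure point spectrum with continuous eigenfunctions means that these are total. -/
lemma eigenfunctionSpace_eq_top [IsProbabilityMeasure m] (h1 : HasPurePointSpectrum G m)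
    (h2 : HasContinuousEigenfunctions G m) : eigenfunctionSpace m G = ⊤ := by
  obtain ⟨S, b, hb, hS⟩ := h1
  rw [← top_le_iff, ← b.dense_span, hb, Subtype.range_coe]
  refine Submodule.topologicalClosure_mono (Submodule.span_mono fun f hf => ?_)
  obtain ⟨ξ, hξ⟩ := hS f hf
  obtain ⟨g, hfg, hg⟩ := h2 ξ f hξ
  have hgf : ContinuousMap.toLp 2 m ℂ g = f :=
    Lp.ext ((ContinuousMap.coeFn_toLp (𝕜 := ℂ) (p := 2) m g).trans hfg.symm)
  refine ⟨g, mem_continuousEigenfunctions (fun h0 => hξ.1 ?_) hg, hgf⟩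
  rw [← hgf, h0, map_zero]

end Spectrum

/-! ### Bohr neighbourhoods -/

section BohrSets

variable (G : Type*) [CommGroup G] [TopologicalSpace G]

lemma continuous_character {G : Type*} [CommGroup G] [TopologicalSpace G] (χ : PontryaginDual G) :
    Continuous fun t : G => (χ t : ℂ) :=
  continuous_subtype_val.comp χ.continuous_toFun

/-- The neighbourhoods of the identity in the Bohr topology. -/
noncomputable def bohrFilter : Filter G :=
  comap (fun (t : G) (χ : PontryaginDual G) => χ t) (𝓝 1)

variable {G}

lemma tendsto_bohrFilter (χ : PontryaginDual G) :
    Tendsto (fun t : G => (χ t : ℂ)) (bohrFilter G) (𝓝 1) := by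
  have h : Tendsto (fun (t : G) (χ : PontryaginDual G) => χ t) (bohrFilter G) (𝓝 1) :=
    tendsto_comap
  exact (continuous_subtype_val.tendsto' (1 : Circle) 1 rfl).comp (tendsto_pi_nhds.1 h χ)

/-- The image of `G` in the product of circles has compact closure, so finitely many translates of
the neighbourhood by image points cover it; the compact set obtained is even finite. -/
lemma relativelyDense_of_mem_bohrFilter {A : Set G} (hA : A ∈ bohrFilter G) :
    RelativelyDense A := by
  obtain ⟨V, hV, hVA⟩ := hA
  let φ (t : G) (χ : PontryaginDual G) : Circle := χ t
  have hφ (s t : G) : (φ s)⁻¹ * φ t = φ (s⁻¹ * t) := by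
    funext χ
    simp [φ]
  let W (t : G) : Set (PontryaginDual G → Circle) := {z | (φ t)⁻¹ * z ∈ interior V}
  obtain ⟨T, hT⟩ := (isClosed_closure (s := Set.range φ)).isCompact.elim_finite_subcover W
    (fun t => isOpen_interior.preimage (continuous_const_mul _)) (by
      intro z hz
      have hopen : {y : PontryaginDual G → Circle | y⁻¹ * z ∈ interior V} ∈ 𝓝 z := by
        refine (isOpen_interior.preimage (by fun_prop)).mem_nhds ?_
        change z⁻¹ * z ∈ interior V
        rw [inv_mul_cancel]
        exact mem_interior_iff_mem_nhds.2 hV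
      obtain ⟨_, hy, t, rfl⟩ := mem_closure_iff_nhds.1 hz _ hopen
      exact Set.mem_iUnion.2 ⟨t, hy⟩)
  refine ⟨T, T.finite_toSet.isCompact, Set.eq_univ_of_forall fun s => ?_⟩
  obtain ⟨t, ht, hs⟩ := Set.mem_iUnion₂.1 (hT (subset_closure ⟨s, rfl⟩))
  refine Set.mem_iUnion₂.2 ⟨t⁻¹ * s, hVA ?_, t, ht, ?_⟩
  · have := interior_subset hs
    rwa [hφ] at this
  · simp [mul_comm]

end BohrSets

/-! ### Approximation by eigenfunctions, almost periodicity and frequencies -/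

section Approximation

variable {G X : Type*} [CommGroup G] [TopologicalSpace G] [IsTopologicalGroup G]
  [MeasurableSpace G] [BorelSpace G] {μ : Measure G} [μ.IsHaarMeasure] {B : ℕ → Set G}
  [MetricSpace X] [CompactSpace X] [MeasurableSpace X] [BorelSpace X]
  [MulAction G X] [ContinuousSMul G X]

/-- The pointwise norm of a continuous function. -/
noncomputable def normMap (h : C(X, ℂ)) : C(X, ℝ) := ⟨fun x => ‖h x‖, h.continuous.norm⟩

@[simp] lemma normMap_apply (h : C(X, ℂ)) (x : X) : normMap h x = ‖h x‖ := rfl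

lemma integral_normMap_le (m : Measure X) [IsProbabilityMeasure m] (h : C(X, ℂ)) {ε : ℝ}
    (hε : 0 < ε) (hh : ‖(ContinuousMap.toLp 2 m ℂ h : Lp ℂ 2 m)‖ ≤ ε) :
    ∫ x, normMap h x ∂m ≤ ε := by
  have hint {F : X → ℝ} (hF : Continuous F) : Integrable F m :=
    hF.integrable_of_hasCompactSupport (HasCompactSupport.of_compactSpace _)
  calc ∫ x, normMap h x ∂m ≤ ∫ x, (ε / 2 + (2 * ε)⁻¹ * ‖h x‖ ^ 2) ∂m := by
        refine integral_mono (hint (by fun_prop)) (hint (by fun_prop)) fun x => ?_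
        -- Completing the square bounds `‖h x‖` by its square, so the `L²` bound gives the `L¹`
        -- bound without loss.
        have : ε / 2 + (2 * ε)⁻¹ * ‖h x‖ ^ 2 - ‖h x‖ = (2 * ε)⁻¹ * (‖h x‖ - ε) ^ 2 := by
          field_simp
          ring
        have : 0 ≤ (2 * ε)⁻¹ * (‖h x‖ - ε) ^ 2 := by positivity
        simp only [normMap_apply]
        linarith
    _ = ε / 2 + (2 * ε)⁻¹ * ‖(ContinuousMap.toLp 2 m ℂ h : Lp ℂ 2 m)‖ ^ 2 := by
        rw [integral_add (integrable_const _) (hint (by fun_prop)), integral_const_mul,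
          norm_toLp_sq]
        simp
    _ ≤ ε / 2 + (2 * ε)⁻¹ * ε ^ 2 := by gcongr
    _ = ε := by
        field_simp
        norm_num

/-- Uniform approximation in the mean by linear combinations of continuous eigenfunctions. -/
lemma exists_eigenfunction_approx (hB : IsFolnerSequence μ B) {m : Measure X}
    (hm : IsUniqueInvariantMeasure G m) [IsProbabilityMeasure m] [SMulInvariantMeasure G X m]
    (hE : eigenfunctionSpace m G = ⊤) (f : C(X, ℂ)) {ε : ℝ} (hε : 0 < ε) :
    ∃ (k : ℕ) (c : Fin k → ℂ) (g : Fin k → C(X, ℂ)) (χ : Fin k → PontryaginDual G),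
      (∀ j, g j ≠ 0) ∧ (∀ j (t : G) (x : X), g j (t • x) = (χ j t : ℂ) * g j x) ∧
      ∀ᶠ n in atTop, ∀ x, orbitAverage μ B n (normMap (f - ∑ j, c j • g j)) x < ε := by
  have hmem : ContinuousMap.toLp 2 m ℂ f ∈ eigenfunctionSpace m G := hE ▸ Submodule.mem_top
  obtain ⟨v, hv, hdist⟩ := Metric.mem_closure_iff.1 hmem (ε / 2) (half_pos hε)
  have himage : Submodule.span ℂ (ContinuousMap.toLp 2 m ℂ '' continuousEigenfunctions G X)
      = Submodule.map (ContinuousMap.toLp 2 m ℂ : C(X, ℂ) →L[ℂ] Lp ℂ 2 m).toLinearMap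
        (Submodule.span ℂ (continuousEigenfunctions G X)) := by
    rw [Submodule.map_span]
    rfl
  rw [SetLike.mem_coe, himage] at hv
  obtain ⟨P, hP, rfl⟩ := hv
  obtain ⟨k, c, g, rfl⟩ := Submodule.mem_span_set'.1 hP
  choose hg0 χ hχ using fun j => (g j).2
  refine ⟨k, c, fun j => g j, χ, hg0, hχ, ?_⟩
  set h := f - ∑ j, c j • (g j : C(X, ℂ))
  have h1 : ∫ x, normMap h x ∂m ≤ ε / 2 := by
    refine integral_normMap_le m h (half_pos hε) ?_
    rw [dist_eq_norm] at hdist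
    rw [map_sub]
    exact hdist.le
  -- Unique ergodicity turns smallness of the integral into smallness of the averages at all points
  -- simultaneously.
  filter_upwards [hm.eventually_orbitAverage hB (normMap h) (half_pos hε)] with n hn x
  have := (abs_lt.1 (hn x)).2
  linarith

lemma orbitAverage_normMap_add_le (hB : IsFolnerSequence μ B) (n : ℕ) {h₁ h₂ h₃ h₄ : C(X, ℂ)}
    {x y : X} {η : ℝ} (h : ∀ u : G, ‖h₁ (u • x) - h₂ (u • y)‖
      ≤ ‖h₃ (u • x)‖ + ‖h₄ (u • y)‖ + η) :
    ∫ u, ‖h₁ (u • x) - h₂ (u • y)‖ ∂(folnerMeasure μ B n)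
      ≤ orbitAverage μ B n (normMap h₃) x + orbitAverage μ B n (normMap h₄) y + η := by
  have := hB.isProbabilityMeasure n
  have hi (h : C(X, ℂ)) (x : X) := integrable_orbit (folnerMeasure μ B n) h x
  rw [orbitAverage_apply hB, orbitAverage_apply hB]
  refine (integral_mono ((hi h₁ x).sub (hi h₂ y)).norm
    (((hi h₃ x).norm.add (hi h₄ y).norm).add (integrable_const η)) h).trans_eq ?_
  rw [integral_add' ((hi h₃ x).norm.add (hi h₄ y).norm) (integrable_const η),
    integral_add' (hi h₃ x).norm (hi h₄ y).norm]
  simp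

/-- Continuous functions are almost invariant in the mean under elements in a Bohr set. -/
lemma eventually_integral_norm_sub_lt (hB : IsFolnerSequence μ B) {m : Measure X}
    (hm : IsUniqueInvariantMeasure G m) [IsProbabilityMeasure m] [SMulInvariantMeasure G X m]
    (hE : eigenfunctionSpace m G = ⊤) (f : C(X, ℂ)) {ε : ℝ} (hε : 0 < ε) :
    ∀ᶠ n in atTop, ∀ᶠ t in bohrFilter G, ∀ x : X,
      ∫ u, ‖f (u • x) - f (u • t • x)‖ ∂(folnerMeasure μ B n) < ε := by
  obtain ⟨k, c, g, χ, -, hχ, hev⟩ := exists_eigenfunction_approx hB hm hE f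
    (by positivity : 0 < ε / 3)
  set P : C(X, ℂ) := ∑ j, c j • g j
  -- This sum bounds the uniform distance between `P` and its translate by `t`; it involves finitely
  -- many characters, hence vanishes along the Bohr filter.
  have hlim : Tendsto (fun t : G => ∑ j, ‖c j‖ * ‖g j‖ * ‖1 - (χ j t : ℂ)‖) (bohrFilter G)
      (𝓝 0) := by
    have : Tendsto (fun t : G => ∑ j, ‖c j‖ * ‖g j‖ * ‖1 - (χ j t : ℂ)‖) (bohrFilter G)
        (𝓝 (∑ j, ‖c j‖ * ‖g j‖ * ‖(1 : ℂ) - 1‖)) :=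
      tendsto_finsetSum _ fun j _ => ((tendsto_bohrFilter (χ j)).const_sub 1).norm.const_mul _
    simpa using this
  have hP (t : G) (x : X) : ‖P x - P (t • x)‖ ≤ ∑ j, ‖c j‖ * ‖g j‖ * ‖1 - (χ j t : ℂ)‖ := by
    have : P x - P (t • x) = ∑ j, c j * (g j x * (1 - (χ j t : ℂ))) := by
      simp only [P, ContinuousMap.coe_sum, Finset.sum_apply, ContinuousMap.coe_smul, Pi.smul_apply,
        smul_eq_mul, hχ, ← Finset.sum_sub_distrib]
      exact Finset.sum_congr rfl fun j _ => by ring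
    rw [this]
    refine (norm_sum_le _ _).trans (Finset.sum_le_sum fun j _ => ?_)
    rw [norm_mul, norm_mul, ← mul_assoc]
    gcongr
    exact (g j).norm_coe_le_norm x
  filter_upwards [hev] with n hn
  filter_upwards [hlim.eventually (gt_mem_nhds (by positivity : 0 < ε / 3))] with t ht x
  have key := orbitAverage_normMap_add_le hB n (h₁ := f) (h₂ := f) (h₃ := f - P) (h₄ := f - P)
    (x := x) (y := t • x) (η := ∑ j, ‖c j‖ * ‖g j‖ * ‖1 - (χ j t : ℂ)‖) (fun u => by
      have h1 := hP t (u • x)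
      rw [smul_comm t u] at h1
      have h2 : f (u • x) - f (u • t • x) = (f - P) (u • x) - (f - P) (u • t • x)
          + (P (u • x) - P (u • t • x)) := by
        simp only [ContinuousMap.sub_apply]
        ring
      rw [h2]
      exact (norm_add_le _ _).trans (add_le_add (norm_sub_le _ _) h1))
  have h1 := hn x
  have h2 := hn (t • x)
  linarith

/-- The metric of a compact space is controlled by finitely many continuous functions. -/
lemma exists_finite_dist_le {ε : ℝ} (hε : 0 < ε) :
    ∃ Q : Finset X, ∀ x y : X, dist x y ≤ 2 * ε + ∑ q ∈ Q, |dist x q - dist y q| := by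
  obtain ⟨Q, -, hQ, hcov⟩ := finite_cover_balls_of_compact (isCompact_univ (X := X)) hε
  lift Q to Finset X using hQ
  refine ⟨Q, fun x y => ?_⟩
  obtain ⟨q, hq, hxq⟩ := Set.mem_iUnion₂.1 (hcov (Set.mem_univ x))
  have h1 : dist x q < ε := hxq
  have h2 := Finset.single_le_sum (f := fun q => |dist x q - dist y q|)
    (fun _ _ => abs_nonneg _) hq
  have h3 := neg_abs_le (dist x q - dist y q)
  have h4 := dist_triangle_right x y q
  linarith

/-- In uniquely ergodic systems with total continuous eigenfunctions, all points are Weyl almost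
periodic. -/
lemma weylAlmostPeriodicPoint_of_eigenfunctionSpace (hB : IsFolnerSequence μ B) {m : Measure X}
    (hm : IsUniqueInvariantMeasure G m) [IsProbabilityMeasure m] [SMulInvariantMeasure G X m]
    (hE : eigenfunctionSpace m G = ⊤) (x : X) : WeylAlmostPeriodicPoint μ B x := by
  intro ε hε
  obtain ⟨Q, hQ⟩ := exists_finite_dist_le (X := X) (by positivity : 0 < ε / 8)
  let f (q : X) : C(X, ℂ) := ⟨fun y => ((dist y q : ℝ) : ℂ), by fun_prop⟩
  -- The functions in `Q` together contribute at most `ε / 4`, the covering error another `ε / 4`;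
  -- the `+ 1` guards against an empty `Q`.
  have hη : 0 < ε / (4 * ((Q.card : ℝ) + 1)) := by positivity
  have hev : ∀ᶠ n in atTop, ∀ q ∈ Q, ∀ᶠ t in bohrFilter G, ∀ x : X,
      ∫ u, ‖f q (u • x) - f q (u • t • x)‖ ∂(folnerMeasure μ B n)
        < ε / (4 * ((Q.card : ℝ) + 1)) :=
    (eventually_all_finset Q).2 fun q _ => eventually_integral_norm_sub_lt hB hm hE (f q) hη
  obtain ⟨N, hN⟩ := hev.exists
  refine ⟨N, relativelyDense_of_mem_bohrFilter ?_⟩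
  filter_upwards [(eventually_all_finset Q).2 hN] with t ht
  have := hB.isProbabilityMeasure N
  refine lt_of_le_of_lt (b := ε / 2) ((averagedDist_le_iff hB).2 fun s => ?_) (by linarith)
  have hi (q y : X) : Integrable (fun u : G => |dist (u • y) q - dist (u • t • y) q|)
      (folnerMeasure μ B N) :=
    ((integrable_orbit _ (⟨fun y => dist y q, by fun_prop⟩ : C(X, ℝ)) y).sub
      (integrable_orbit _ (⟨fun y => dist y q, by fun_prop⟩ : C(X, ℝ)) (t • y))).abs
  have hle (q : X) (hq : q ∈ Q) (y : X) :
      ∫ u, |dist (u • y) q - dist (u • t • y) q| ∂(folnerMeasure μ B N)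
        ≤ ε / (4 * ((Q.card : ℝ) + 1)) := by
    refine le_of_eq_of_le ?_ (ht q hq y).le
    refine integral_congr_ae (Eventually.of_forall fun u => ?_)
    change _ = ‖((dist (u • y) q : ℝ) : ℂ) - ((dist (u • t • y) q : ℝ) : ℂ)‖
    rw [← Complex.ofReal_sub, Complex.norm_real, Real.norm_eq_abs]
  rw [orbitAverage_apply hB]
  calc ∫ u, distMap X (u • s • (x, t • x)) ∂(folnerMeasure μ B N)
      ≤ ∫ u, (2 * (ε / 8) + ∑ q ∈ Q, |dist (u • s • x) q - dist (u • t • s • x) q|)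
          ∂(folnerMeasure μ B N) := by
        refine integral_mono (integrable_orbit _ _ _)
          ((integrable_const _).add (integrable_finsetSum _ fun q _ => hi q (s • x))) fun u => ?_
        rw [smul_comm t s x]
        exact hQ (u • s • x) (u • s • t • x)
    _ = 2 * (ε / 8) + ∑ q ∈ Q, ∫ u, |dist (u • s • x) q - dist (u • t • s • x) q|
          ∂(folnerMeasure μ B N) := by
        rw [integral_add (integrable_const _) (integrable_finsetSum _ fun q _ => hi q (s • x)),
          integral_finsetSum _ fun q _ => hi q (s • x)]
        simp
    _ ≤ 2 * (ε / 8) + Q.card • (ε / (4 * ((Q.card : ℝ) + 1))) := by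
        gcongr
        exact Finset.sum_le_card_nsmul _ _ _ fun q hq => hle q hq (s • x)
    _ ≤ ε / 2 := by
        have : Q.card • (ε / (4 * ((Q.card : ℝ) + 1))) = ε / 4 * (Q.card / ((Q.card : ℝ) + 1)) := by
          rw [nsmul_eq_mul]
          field_simp
        have h2 : (Q.card : ℝ) / ((Q.card : ℝ) + 1) ≤ 1 :=
          (div_le_one (by positivity)).2 (by linarith)
        rw [this]
        nlinarith

/-- Along the orbit of `x` an eigenfunction is its value at `x` times a character, so the
eigenfunction approximation restricts to a trigonometric one. -/
lemma besicovitchAlmostPeriodicPoint_of_eigenfunctionSpace (hB : IsFolnerSequence μ B)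
    {m : Measure X} (hm : IsUniqueInvariantMeasure G m) [IsProbabilityMeasure m]
    [SMulInvariantMeasure G X m] (hE : eigenfunctionSpace m G = ⊤) (x : X) :
    BesicovitchAlmostPeriodicPoint μ B x := by
  intro f ε hε
  obtain ⟨k, c, g, χ, -, hχ, hev⟩ := exists_eigenfunction_approx hB hm hE f (half_pos hε)
  refine ⟨k, χ, fun j => c j * g j x, ?_⟩
  set h := f - ∑ j, c j • g j with hh
  have heq : (fun t : G => ‖f (t • x) - ∑ j, c j * g j x * (χ j t : ℂ)‖)
      = fun t : G => normMap h (t • x) := by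
    funext t
    simp only [normMap_apply, hh, ContinuousMap.sub_apply, ContinuousMap.coe_sum, Finset.sum_apply,
      ContinuousMap.coe_smul, Pi.smul_apply, smul_eq_mul, hχ]
    congr 2
    exact Finset.sum_congr rfl fun j _ => by ring
  rw [heq, upperMean]
  simp_rw [windowMean_orbit hB, one_smul]
  exact (limsup_lt_iff_of_abs_le fun n => abs_orbitAverage_le hB n (normMap h) x).2
    ⟨ε / 2, half_lt_self hε, hev.mono fun n hn => (hn x).le⟩

/-- The means of a nontrivial character along a Følner sequence vanish. -/
lemma tendsto_integral_character (hB : IsFolnerSequence μ B) {χ ξ : PontryaginDual G}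
    (h : χ ≠ ξ) :
    Tendsto (fun n => ∫ t, (χ t : ℂ) * (starRingEnd ℂ) (ξ t : ℂ) ∂(folnerMeasure μ B n)) atTop
      (𝓝 0) := by
  obtain ⟨v, hv⟩ : ∃ v, χ v ≠ ξ v := by
    by_contra! hcon
    exact h (DFunLike.ext _ _ hcon)
  let η (t : G) : ℂ := (χ t : ℂ) * (starRingEnd ℂ) (ξ t : ℂ)
  have hcont : Continuous η :=
    (continuous_character χ).mul (Complex.continuous_conj.comp (continuous_character ξ))
  have hmul (s t : G) : η (s * t) = η s * η t := by
    simp only [η, map_mul, Circle.coe_mul]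
    ring
  have hv1 : η v - 1 ≠ 0 := by
    intro h0
    refine hv (Circle.ext ?_)
    have h1 : (starRingEnd ℂ) (ξ v : ℂ) * (ξ v : ℂ) = 1 := by
      rw [mul_comm, Complex.mul_conj, Complex.normSq_eq_norm_sq, Circle.norm_coe]
      norm_num
    calc (χ v : ℂ) = η v * (ξ v : ℂ) := by simp only [η]; rw [mul_assoc, h1, mul_one]
      _ = ξ v := by rw [sub_eq_zero.1 h0, one_mul]
  -- Translation by `v` multiplies the mean by `η v ≠ 1` but changes it asymptotically by nothing.
  have hlim := tendsto_integral_translate_sub hB v (f := fun _ => η) (C := 1)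
    (fun _ => hcont.aestronglyMeasurable) (fun _ u => by
      rw [norm_mul, RCLike.norm_conj, Circle.norm_coe, Circle.norm_coe, one_mul]) tendsto_id
  have := hlim.const_mul (η v - 1)⁻¹
  rw [mul_zero] at this
  refine this.congr fun n => ?_
  simp_rw [hmul, integral_const_mul]
  rw [← sub_one_mul, inv_mul_cancel_left₀ hv1]
  rfl

lemma integrable_orbit_mul_conj (n : ℕ) (hB : IsFolnerSequence μ B) (f : C(X, ℂ))
    (ξ : PontryaginDual G) (x : X) :
    Integrable (fun t : G => f (t • x) * (starRingEnd ℂ) (ξ t : ℂ)) (folnerMeasure μ B n) := by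
  have := hB.isProbabilityMeasure n
  refine Integrable.of_bound (C := ‖f‖) ((continuous_orbit f x).mul
    (Complex.continuous_conj.comp
      (continuous_character ξ))).aestronglyMeasurable
    (Eventually.of_forall fun u => ?_)
  rw [norm_mul, RCLike.norm_conj, Circle.norm_coe, mul_one]
  exact f.norm_coe_le_norm _

/-- If `ξ` is not an eigenvalue, a sum of eigenfunctions approximating `f` within `‖a‖ / 2` has
vanishing correlation with `ξ`, which forces `‖a‖ ≤ ‖a‖ / 2`. -/
lemma freq_subset_eig (hB : IsFolnerSequence μ B) {m : Measure X}
    (hm : IsUniqueInvariantMeasure G m) [IsProbabilityMeasure m] [SMulInvariantMeasure G X m]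
    (hE : eigenfunctionSpace m G = ⊤) {p : X} (hp : Dense (MulAction.orbit G p)) (x : X) :
    Freq μ B x ⊆ Eig G m := by
  rintro ξ ⟨f, a, ha, hfa⟩
  by_contra hξ
  have ha' : 0 < ‖a‖ := norm_pos_iff.2 ha
  obtain ⟨k, c, g, χ, hg, hχ, hev⟩ := exists_eigenfunction_approx hB hm hE f (half_pos ha')
  have hne (j : Fin k) : χ j ≠ ξ := by
    rintro rfl
    obtain ⟨e, he, heχ⟩ := exists_unimodular_eigenfunction hp (hg j) (hχ j)
    exact hξ ⟨_, (isEigenfunctionFor_toLp he heχ).1⟩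
  set P : C(X, ℂ) := ∑ j, c j • g j with hP
  have hPlim : Tendsto (fun n => ∫ t, P (t • x) * (starRingEnd ℂ) (ξ t : ℂ)
      ∂(folnerMeasure μ B n)) atTop (𝓝 0) := by
    have h1 := tendsto_finsetSum Finset.univ fun j _ =>
      (tendsto_integral_character hB (hne j)).const_mul (c j * g j x)
    simp only [mul_zero, Finset.sum_const_zero] at h1
    refine h1.congr fun n => ?_
    have h2 (t : G) : P (t • x) * (starRingEnd ℂ) (ξ t : ℂ)
        = ∑ j, c j * (g j (t • x) * (starRingEnd ℂ) (ξ t : ℂ)) := by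
      simp only [hP, ContinuousMap.coe_sum, Finset.sum_apply, ContinuousMap.coe_smul, Pi.smul_apply,
        smul_eq_mul, Finset.sum_mul]
      exact Finset.sum_congr rfl fun j _ => by ring
    simp_rw [h2]
    rw [integral_finsetSum _ fun j _ => (integrable_orbit_mul_conj n hB (g j) ξ x).const_mul _]
    refine Finset.sum_congr rfl fun j _ => ?_
    rw [← integral_const_mul]
    refine integral_congr_ae (Eventually.of_forall fun t => ?_)
    simp only [hχ]
    ring
  have hlim := (hfa.sub hPlim).norm
  rw [sub_zero] at hlim
  refine absurd (le_of_tendsto hlim ?_) (not_le.2 (half_lt_self ha'))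
  filter_upwards [hev] with n hn
  refine le_trans ?_ (hn x).le
  rw [windowMean_one, ← integral_sub (integrable_orbit_mul_conj n hB f ξ x)
    (integrable_orbit_mul_conj n hB P ξ x), orbitAverage_apply hB]
  refine (norm_integral_le_integral_norm _).trans_eq
    (integral_congr_ae (Eventually.of_forall fun t => ?_))
  simp only [← sub_mul, norm_mul, RCLike.norm_conj, Circle.norm_coe, mul_one]
  rfl

/-- The continuous eigenfunction itself is the test function: multiplied by the conjugate character
it is constant on the orbit, and nowhere zero. -/
lemma eig_subset_freq (hB : IsFolnerSequence μ B) {m : Measure X}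
    (hc : HasContinuousEigenfunctions G m) {p : X} (hp : Dense (MulAction.orbit G p)) (x : X) :
    Eig G m ⊆ Freq μ B x := by
  rintro ξ ⟨f, hf⟩
  obtain ⟨g, hfg, hg⟩ := hc _ f hf
  have hg0 : g ≠ 0 := by
    rintro rfl
    exact hf.1 (Lp.ext (hfg.trans (Lp.coeFn_zero ℂ 2 m).symm))
  refine ⟨g, g x, eigenfunction_apply_ne_zero hp hg0 hg x, ?_⟩
  refine tendsto_const_nhds.congr fun n => ?_
  have := hB.isProbabilityMeasure n
  have h1 (t : G) : g (t • x) * (starRingEnd ℂ) (ξ t : ℂ) = g x := by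
    rw [hg, mul_right_comm, Complex.mul_conj, Complex.normSq_eq_norm_sq, Circle.norm_coe]
    simp
  rw [windowMean_one]
  simp [h1]

end Approximation

/-! ### The main theorem -/

theorem mainTheorem5 {G X : Type*}
    [CommGroup G] [TopologicalSpace G] [IsTopologicalGroup G] [T2Space G]
    [LocallyCompactSpace G] [SigmaCompactSpace G] [MeasurableSpace G] [BorelSpace G]
    (μ : Measure G) [μ.IsHaarMeasure] [μ.Regular]
    [MetricSpace X] [CompactSpace X] [MeasurableSpace X] [BorelSpace X]
    [MulAction G X] [ContinuousSMul G X]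
    (B : ℕ → Set G) (hB : IsFolnerSequence μ B)
    (p : X) (hp : Dense (MulAction.orbit G p)) :
    List.TFAE
      [ ∃ m : Measure X, IsUniqueInvariantMeasure G m ∧
          HasPurePointSpectrum G m ∧ HasContinuousEigenfunctions G m,
        WeylAlmostPeriodicPoint μ B p,
        ∀ x : X, WeylAlmostPeriodicPoint μ B x ] ∧
    ∀ m : Measure X, IsUniqueInvariantMeasure G m → HasPurePointSpectrum G m →
      HasContinuousEigenfunctions G m →
        ∀ x : X, BesicovitchAlmostPeriodicPoint μ B x ∧ Freq μ B x = Eig G m := by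
  refine ⟨?_, fun m hm h1 h2 x => ?_⟩
  · tfae_have 1 → 3 := by
      rintro ⟨m, hm, h1, h2⟩ x
      have := hm.1.1
      have := hm.1.2
      exact weylAlmostPeriodicPoint_of_eigenfunctionSpace hB hm (eigenfunctionSpace_eq_top h1 h2) x
    tfae_have 3 → 2 := fun h => h p
    tfae_have 2 → 1 := by
      intro h
      have : Nonempty X := ⟨p⟩
      obtain ⟨m, _, _⟩ := exists_invariant_measure (Y := X) hB
      have hE := h.eigenfunctionSpace_eq_top m hB hp
      exact ⟨m, h.isUniqueInvariantMeasure hB hp, hasPurePointSpectrum_of_eigenfunctionSpace hp hE,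
        hasContinuousEigenfunctions_of_eigenfunctionSpace hp hE⟩
    tfae_finish
  · have := hm.1.1
    have := hm.1.2
    have hE := eigenfunctionSpace_eq_top h1 h2
    exact ⟨besicovitchAlmostPeriodicPoint_of_eigenfunctionSpace hB hm hE x,
      (freq_subset_eig hB hm hE hp x).antisymm (eig_subset_freq hB h2 hp x)⟩
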